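/- Let $\mathbb F_q$ be a finite field, let $\mathfrak n$ be a finite-dimensional nilpotent associative $\mathbb F_q$-algebra with dual space $\mathfrak n^*$, and let $G=1+\mathfrak n$ be the group of formal sums $1+X$ ($X\in\mathfrak n$) with $(1+X)(1+Y)=1+X+Y+XY$. For a subalgebra $\mathfrak h\subset\mathfrak n$ the set $1+\mathfrak h$ is a subgroup of $G$. Fix a nontrivial homomorphism $\theta:\mathbb F_q^+\to\mathbb C^\times$. For $\lambda\in\mathfrak n^*$, $g\in G$, $X\in\mathfrak n$ put \[ \theta_\lambda(g)=\theta(\lambda(g-1)),\quad (g\lambda)(X)=\lambda(g^{-1}X),\quad (\lambda g)(X)=\lambda(Xg^{-1}),\quad \lambda^g(X)=\lambda(gXg^{-1}), \] let $\lambda^G=\{\lambda^g:g\in G\}$, and let $\psi_\lambda=|\lambda^G|^{-1/2}\sum_{\mu\in\lambda^G}\theta_\mu$ be the Kirillov function of $\lambda$. Put $\mathfrak l_\lambda^0=0$, $\mathfrak s_\lambda^0=\mathfrak n$ and, for $i\ge 0$, \[ \mathfrak l_\lambda^{i+1}=\{X\in\mathfrak s_\lambda^i:\lambda(XY)=0\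 \forall\, Y\in\mathfrak s_\lambda^i\},\qquad \mathfrak s_\lambda^{i+1}=\{X\in\mathfrak s_\lambda^i:\lambda(XY)=0\ \forall\, Y\in\mathfrak l_\lambda^{i+1}\}. \] These are subalgebras of $\mathfrak n$. Let $d\ge1$ be such that $\mathfrak s_\lambda^{d-1}=\mathfrak s_\lambda^{d}$ (both sequences are constant from index $d$ on) and define the subgroups $\overline L_\lambda=1+\mathfrak l_\lambda^d$ and $\overline S_\lambda=1+\mathfrak s_\lambda^d$ of $G$. Define \[ \xi_\lambda=\mathrm{Ind}_{\overline L_\lambda}^G(\theta_\lambda),\quad\text{i.e. } \xi_\lambda(g)=\frac1{|\overline L_\lambda|}\sum_{x\in G,\ xgx^{-1}\in\overline L_\lambda}\theta_\lambda(xgx^{-1}),\qquad \Xi_\lambda=\{g\lambda sg^{-1}:g\in G,\ s\in\overline S_\lambda\}\subset\mathfrak n^*. \] Let $\langle f,h\rangle_G=\frac1{|G|}\sum_{x\in G}f(x)\overline{h(x)}$, let $\mathrm{Irr}(G)$ be the set of irreducible complex characters of $G$, and for a character $\chi$ let $\mathrm{Irr}(G,\chi)=\{\psi\in\mathrm{Irr}(G):\langle\chi,\psi\rangle_G>0\}$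 be the set of its irreducible constituents. Then each $\xi_\lambda$ is a character of $G$, and for all $\lambda,\lambda'\in\mathfrak n^*$: (1) $\displaystyle\xi_\lambda=\frac{|\overline S_\lambda|}{|G|}\sum_{\nu\in\Xi_\lambda}\theta_\nu$ and $\displaystyle|\Xi_\lambda|=\frac{|G|^2}{|\overline L_\lambda|\,|\overline S_\lambda|}$. (2) $\xi_\lambda=\xi_{\lambda'}$ if and only if $\lambda'\in\Xi_\lambda$, and if $\lambda'\notin\Xi_\lambda$ then $\xi_\lambda$ and $\xi_{\lambda'}$ share no irreducible constituents. In particular, $\langle\xi_\lambda,\xi_{\lambda'}\rangle_G$ equals $|\overline S_\lambda|/|\overline L_\lambda|$ if $\lambda'\in\Xi_\lambda$ and $0$ otherwise. (3) If $\xi_\lambda$ is irreducible, then $\xi_\lambda=\psi_\lambda$. (4) The sets $\mathrm{Irr}(G,\xi)$, for $\xi$ in the set of characters $\{\xi_\lambda:\lambda\in\mathfrak n^*\}$, are nonempty, pairwise disjoint and have union $\mathrm{Irr}(G)$; and for every set $R\subset\mathfrak n^*$ such that $\mathfrak n^*=\bigcup_{\nu\in R}\Xi_\nu$ is a disjoint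 union, the character $\rho_G$ of the regular representation of $G$ is \[ \rho_G=\sum_{\nu\in R}\frac{|G|}{|\overline S_\nu|}\,\xi_\nu. \] -/

import Mathlib

noncomputable section

/-- The (not necessarily unital) associative ring `n` is nilpotent: there is a `k` such that every
product `x₁ (x₂ (⋯ (xₖ x)))` of `k + 1` elements vanishes. -/
class IsNilpotentAlgebra (n : Type*) [NonUnitalRing n] : Prop where
  exists_prod_eq_zero : ∃ k : ℕ, ∀ (l : List n) (x : n), l.length = k → l.foldr (· * ·) x = 0

/-- The underlying set of the algebra group `1 + n`: the formal sums `1 + X` with `X ∈ n`.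
The element `1 + X` is `⟨X⟩`, and `g.val` is `g - 1`. -/
@[ext]
structure AlgGroup (n : Type*) where
  val : n

namespace AlgGroup

section Group

variable {n : Type*} [NonUnitalRing n]

/-- The partial sums `-X + X² - X³ + ⋯` of `(1 + X)⁻¹ - 1`. -/
def invSeq (X : n) : ℕ → n
  | 0 => 0
  | k + 1 => -X - X * invSeq X k

theorem invSeq_sub (X : n) (k : ℕ) :
    invSeq X (k + 1) - invSeq X k = (List.replicate k (-X)).foldr (· * ·) (-X) := by
  induction k with
  | zero => simp [invSeq]
  | succ k ih =>
    rw [List.replicate_succ, List.foldr_cons, ← ih]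
    simp only [invSeq, neg_mul, mul_sub, mul_neg]
    abel

instance : One (AlgGroup n) := ⟨⟨0⟩⟩

/-- `(1 + X)(1 + Y) = 1 + X + Y + XY`. -/
instance : Mul (AlgGroup n) := ⟨fun g h => ⟨g.val + h.val + g.val * h.val⟩⟩

@[simp] theorem val_one : (1 : AlgGroup n).val = 0 := rfl

@[simp] theorem val_mul (g h : AlgGroup n) : (g * h).val = g.val + h.val + g.val * h.val := rfl

variable [IsNilpotentAlgebra n]

instance : Inv (AlgGroup n) :=
  ⟨fun g => ⟨invSeq g.val (Classical.choose (IsNilpotentAlgebra.exists_prod_eq_zero (n := n)))⟩⟩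

theorem val_inv_eq (g : AlgGroup n) : ∃ k, g⁻¹.val = invSeq g.val k := ⟨_, rfl⟩

theorem mul_inv_aux (g : AlgGroup n) : g * g⁻¹ = 1 := by
  have h := Classical.choose_spec (IsNilpotentAlgebra.exists_prod_eq_zero (n := n))
  have h2 := invSeq_sub g.val
    (Classical.choose (IsNilpotentAlgebra.exists_prod_eq_zero (n := n)))
  rw [h _ _ (by simp)] at h2
  have h3 : -g.val - g.val * g⁻¹.val - g⁻¹.val = 0 := h2
  ext
  rw [val_mul, val_one, ← neg_eq_zero, ← h3]
  abel

instance : Group (AlgGroup n) :=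
  Group.ofRightAxioms
    (fun a b c => by ext; simp only [val_mul, add_mul, mul_add, mul_assoc]; abel)
    (fun a => by ext; simp)
    mul_inv_aux

end Group

end AlgGroup

section Characters

/-! ### Functions and characters on a finite group -/

variable {G : Type*} [Group G]

/-- `⟨f, h⟩_G = |G|⁻¹ ∑ f(x) conj(h(x))`. -/
def groupInner (f h : G → ℂ) : ℂ :=
  (Nat.card G : ℂ)⁻¹ * ∑ᶠ x : G, f x * (starRingEnd ℂ) (h x)

/-- The function induced from the restriction of `f` to `H`, by the Frobenius formula. -/
def indFun (H : Subgroup G) (f : G → ℂ) (g : G) : ℂ :=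
  (Nat.card H : ℂ)⁻¹ * ∑ᶠ (x : G) (_ : x * g * x⁻¹ ∈ H), f (x * g * x⁻¹)

/-- `f` is the character of a finite-dimensional complex representation of `G`. -/
def IsChar (f : G → ℂ) : Prop :=
  ∃ (d : ℕ) (ρ : Representation ℂ G (Fin d → ℂ)), f = ρ.character

variable (G) in
/-- The set `Irr(G)` of irreducible complex characters. -/
def irrChars : Set (G → ℂ) :=
  {f | ∃ (d : ℕ) (ρ : Representation ℂ G (Fin d → ℂ)), ρ.IsIrreducible ∧ f = ρ.character}

open scoped ComplexOrder in
/-- The set `Irr(G, χ)` of irreducible constituents of a character `χ`. -/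
def irrConstituents (χ : G → ℂ) : Set (G → ℂ) :=
  {ψ | ψ ∈ irrChars G ∧ 0 < groupInner χ ψ}

variable (G) in
/-- The character `ρ_G` of the regular representation. -/
def regularChar : G → ℂ := (Representation.leftRegular ℂ G).character

end Characters

namespace AlgGroup

variable {F n : Type*} [Field F] [NonUnitalRing n] [Module F n]
  [IsScalarTower F n n] [SMulCommClass F n n]

/-! ### Actions on the algebra and on its dual -/

variable (F) in
/-- Left multiplication `X ↦ gX` by a group element. -/
def lmul (g : AlgGroup n) : n →ₗ[F] n := LinearMap.id + LinearMap.mulLeft F g.val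

variable (F) in
/-- Right multiplication `X ↦ Xg` by a group element. -/
def rmul (g : AlgGroup n) : n →ₗ[F] n := LinearMap.id + LinearMap.mulRight F g.val

section Actions

variable [IsNilpotentAlgebra n]

/-- `gλ`, where `gλ(X) = λ(g⁻¹X)`. -/
def leftAct (g : AlgGroup n) (lam : Module.Dual F n) : Module.Dual F n := lam ∘ₗ lmul F g⁻¹

/-- `λg`, where `λg(X) = λ(Xg⁻¹)`. -/
def rightAct (lam : Module.Dual F n) (g : AlgGroup n) : Module.Dual F n := lam ∘ₗ rmul F g⁻¹

/-- The coadjoint action `λ^g(X) = λ(gXg⁻¹)`. -/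
def coadj (lam : Module.Dual F n) (g : AlgGroup n) : Module.Dual F n :=
  lam ∘ₗ lmul F g ∘ₗ rmul F g⁻¹

/-- The coadjoint orbit `λ^G`. -/
def coadjOrbit (lam : Module.Dual F n) : Set (Module.Dual F n) :=
  Set.range (coadj lam)

/-- The algebra subgroup `1 + h` attached to a subalgebra `h`. -/
def algSubgroup (h : NonUnitalSubalgebra F n) : Subgroup (AlgGroup n) where
  carrier := {g | g.val ∈ h}
  one_mem' := h.zero_mem
  mul_mem' ha hb := h.add_mem (h.add_mem ha hb) (h.mul_mem ha hb)
  inv_mem' := by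
    intro g hg
    obtain ⟨k, hk⟩ := val_inv_eq g
    change g⁻¹.val ∈ h
    rw [hk]
    clear hk
    induction k with
    | zero => exact h.zero_mem
    | succ k ih => exact h.sub_mem (h.neg_mem hg) (h.mul_mem hg ih)

end Actions

/-! ### The iterated left-kernel chain -/

/-- The left kernel `{X ∈ s : λ(XY) = 0 for all Y ∈ s}` of `(X, Y) ↦ λ(XY)` on `s × s`. -/
def lStep (lam : Module.Dual F n) (s : NonUnitalSubalgebra F n) : NonUnitalSubalgebra F n where
  carrier := {X | X ∈ s ∧ ∀ Y ∈ s, lam (X * Y) = 0}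
  zero_mem' := ⟨s.zero_mem, by simp⟩
  add_mem' ha hb := ⟨s.add_mem ha.1 hb.1, fun Y hY => by
    rw [add_mul, map_add, ha.2 Y hY, hb.2 Y hY, add_zero]⟩
  smul_mem' c X hX := ⟨s.smul_mem c hX.1, fun Y hY => by
    rw [smul_mul_assoc, map_smul, hX.2 Y hY, smul_zero]⟩
  mul_mem' {a b} ha hb := ⟨s.mul_mem ha.1 hb.1, fun Y hY => by
    rw [mul_assoc]; exact ha.2 _ (s.mul_mem hb.1 hY)⟩

/-- The left kernel `{X ∈ s : λ(XY) = 0 for all Y ∈ l}` of `(X, Y) ↦ λ(XY)` on `s × l`, where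
`l = lStep lam s`. -/
def sStep (lam : Module.Dual F n) (s : NonUnitalSubalgebra F n) : NonUnitalSubalgebra F n where
  carrier := {X | X ∈ s ∧ ∀ Y ∈ lStep lam s, lam (X * Y) = 0}
  zero_mem' := ⟨s.zero_mem, by simp⟩
  add_mem' ha hb := ⟨s.add_mem ha.1 hb.1, fun Y hY => by
    rw [add_mul, map_add, ha.2 Y hY, hb.2 Y hY, add_zero]⟩
  smul_mem' c X hX := ⟨s.smul_mem c hX.1, fun Y hY => by
    rw [smul_mul_assoc, map_smul, hX.2 Y hY, smul_zero]⟩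
  mul_mem' {a b} ha hb := ⟨s.mul_mem ha.1 hb.1, fun Y hY => by
    rw [mul_assoc]
    refine ha.2 _ ⟨s.mul_mem hb.1 hY.1, fun Z hZ => ?_⟩
    rw [mul_assoc]
    refine hb.2 _ ⟨s.mul_mem hY.1 hZ, fun W hW => ?_⟩
    rw [mul_assoc]
    exact hY.2 _ (s.mul_mem hZ hW)⟩

/-- The descending chain `s_λ^i`. -/
def sChain (lam : Module.Dual F n) : ℕ → NonUnitalSubalgebra F n
  | 0 => ⊤
  | i + 1 => sStep lam (sChain lam i)

/-- The ascending chain `l_λ^i`. -/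
def lChain (lam : Module.Dual F n) : ℕ → NonUnitalSubalgebra F n
  | 0 => ⊥
  | i + 1 => lStep lam (sChain lam i)

/-- The least `d ≥ 1` with `s_λ^{d-1} = s_λ^d`; from this index on both chains are constant. -/
def chainEnd (lam : Module.Dual F n) : ℕ :=
  sInf {d | 1 ≤ d ∧ sChain lam (d - 1) = sChain lam d}

/-- In finite dimension the index `chainEnd` is the minimum of a nonempty set. -/
theorem chainEnd_spec [Module.Finite F n] (lam : Module.Dual F n) :
    1 ≤ chainEnd lam ∧ sChain lam (chainEnd lam - 1) = sChain lam (chainEnd lam) := by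
  refine Nat.sInf_mem (s := {d | 1 ≤ d ∧ sChain lam (d - 1) = sChain lam d}) ?_
  have hanti : Antitone (fun i => (sChain lam i).toSubmodule) :=
    antitone_nat_of_succ_le fun i X hX => hX.1
  obtain ⟨m, hm⟩ := IsArtinian.monotone_stabilizes (R := F) (M := n)
    ⟨fun i => OrderDual.toDual (sChain lam i).toSubmodule, hanti⟩
  refine ⟨m + 1, by omega, ?_⟩
  have := hm (m + 1) (by omega)
  ext X
  exact SetLike.ext_iff.mp (OrderDual.toDual.injective this) X

/-- The terminal term `l̄_λ` of the ascending chain. -/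
def lBar (lam : Module.Dual F n) : NonUnitalSubalgebra F n := lChain lam (chainEnd lam)

/-- The terminal term `s̄_λ` of the descending chain. -/
def sBar (lam : Module.Dual F n) : NonUnitalSubalgebra F n := sChain lam (chainEnd lam)

/-! ### Functions on the algebra group indexed by the dual space -/

/-- `θ_λ(g) = θ(λ(g - 1))`. -/
def thetaFun (θ : AddChar F ℂ) (lam : Module.Dual F n) (g : AlgGroup n) : ℂ :=
  θ (lam g.val)

variable [IsNilpotentAlgebra n]

/-- The algebra subgroup `L̄_λ = 1 + l̄_λ`. -/
def LBar (lam : Module.Dual F n) : Subgroup (AlgGroup n) := algSubgroup (lBar lam)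

/-- The algebra subgroup `S̄_λ = 1 + s̄_λ`. -/
def SBar (lam : Module.Dual F n) : Subgroup (AlgGroup n) := algSubgroup (sBar lam)

/-- The Kirillov function `ψ_λ = |λ^G|^{-1/2} ∑_{μ ∈ λ^G} θ_μ`. -/
def kirillov (θ : AddChar F ℂ) (lam : Module.Dual F n) (g : AlgGroup n) : ℂ :=
  ((Real.sqrt ((coadjOrbit lam).ncard : ℝ) : ℝ) : ℂ)⁻¹ *
    ∑ᶠ μ ∈ coadjOrbit lam, thetaFun θ μ g

/-- `ξ_λ = Ind_{L̄_λ}^G(θ_λ)`. -/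
def xi (θ : AddChar F ℂ) (lam : Module.Dual F n) : AlgGroup n → ℂ :=
  indFun (LBar lam) (thetaFun θ lam)

/-- `Ξ_λ = {gλsg⁻¹ : g ∈ G, s ∈ S̄_λ}`. -/
def Xi (lam : Module.Dual F n) : Set (Module.Dual F n) :=
  {ν | ∃ g : AlgGroup n, ∃ s ∈ SBar lam, ν = rightAct (leftAct g (rightAct lam s)) g⁻¹}

end AlgGroup

end

/-! Write `l`, `s` for the terminal terms `lBar lam`, `sBar lam`. By Fourier inversion, the
extension of `θ_λ` by zero from `l` is the average of the `θ_ν` over all `ν` agreeing with `λ` on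
`l` (`sum_eqOn_lBar`). Summing over conjugates, the coefficient of `θ_μ` in `ξ_λ` is, up to
normalization, the number of `x` for which `coadj μ x` agrees with `λ` on `l`. Everything rests on
this count, `card_coadj_eqOn_lBar`: it is `|S̄_λ|` for `μ ∈ Ξ_λ` and `0` otherwise.

The count has two ingredients. The stabilizer of the restriction of `λ` to `l` is exactly `S̄_λ`
(`eqOn_lBar_coadj_iff`). Every `μ` agreeing with `λ` on `l` lies in `Ξ_λ` (`mem_Xi_of_eqOn_lBar`):
on `s` the difference `μ - λ` kills the left kernel `l`, hence is `X ↦ λ(XA)` with `A ∈ s`, so `μ`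
agrees on `s` with a right translate of `λ`. Functionals agreeing on `s` are conjugate, by climbing
back up the chain (`exists_eq_coadj_of_eqOn_sChain`).

Since the chains are unchanged by right translation by `S̄_λ` and equivariant under conjugation, the
sets `Ξ_λ` partition the dual (`Xi_eq_of_mem`). Orthonormality of the `θ_ν` then gives all inner
products, and evaluation at `1` gives `|Ξ_λ|`. Orthogonal characters share no constituents. Norm one
forces `S̄_λ = L̄_λ`, in which case `Ξ_λ` is the coadjoint orbit. Finally, the sum of all `θ_ν` is
the regular character, so every irreducible character occurs in some `ξ_λ`. -/

set_option linter.unusedSectionVars false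

/-! ### Complex characters of finite groups. -/

noncomputable section CharacterTheory

variable {G : Type*} [Group G]

/-- The character of a complex representation of a finite group takes conjugate values on
inverse elements. -/
theorem Representation.character_inv_eq_conj [Finite G] {d : ℕ}
    (ρ : Representation ℂ G (Fin d → ℂ)) (g : G) :
    ρ.character g⁻¹ = (starRingEnd ℂ) (ρ.character g) := by
  classical
  open scoped ComplexOrder Matrix in
  have := Fintype.ofFinite G
  let A : G → Matrix (Fin d) (Fin d) ℂ := fun g => LinearMap.toMatrix' (ρ g)
  have hmul : ∀ a b, A (a * b) = A a * A b := fun a b => by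
    simp only [A, map_mul, LinearMap.toMatrix'_mul]
  have hone : A 1 = 1 := by simp [A]
  have htr : ∀ a, ρ.character a = (A a).trace := fun a => by
    simp only [A, Representation.character]
    exact LinearMap.trace_eq_matrix_trace ℂ (Pi.basisFun ℂ (Fin d)) (ρ a)
  -- The averaged Hermitian form is `G`-invariant, so `A g⁻¹` is conjugate under `H` to the adjoint
  -- of `A g`, and traces can be compared.
  let H : Matrix (Fin d) (Fin d) ℂ := ∑ a : G, (A a)ᴴ * A a
  have hH : H.PosDef := by
    -- Splitting off the identity term, which is the identity matrix, upgrades semidefinite to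
    -- definite.
    have : H = (∑ a ∈ Finset.univ.erase (1 : G), (A a)ᴴ * A a) + 1 := by
      simp only [H]
      rw [← Finset.sum_erase_add _ _ (Finset.mem_univ (1 : G)), hone]
      simp
    rw [this]
    exact Matrix.PosDef.posSemidef_add
      (Matrix.posSemidef_sum _ fun a _ => Matrix.posSemidef_conjTranspose_mul_self (A a))
      Matrix.PosDef.one
  have hinv : (A g)ᴴ * H * A g = H := by
    simp only [H, Finset.mul_sum, Finset.sum_mul]
    refine Fintype.sum_equiv (Equiv.mulRight g) _ _ fun a => ?_
    simp only [Equiv.coe_mulRight, hmul, Matrix.conjTranspose_mul, Matrix.mul_assoc]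
  have hgi : A g * A g⁻¹ = 1 := by rw [← hmul, mul_inv_cancel, hone]
  have hu : IsUnit H := hH.isUnit
  have hdet : IsUnit H.det := (Matrix.isUnit_iff_isUnit_det H).1 hu
  have h1 : (A g)ᴴ * H = H * A g⁻¹ := by
    rw [← congrArg (· * A g⁻¹) hinv]
    simp only [Matrix.mul_assoc, hgi, Matrix.mul_one]
  have h2 : A g⁻¹ = H⁻¹ * ((A g)ᴴ * H) := by
    rw [h1, ← Matrix.mul_assoc, Matrix.nonsing_inv_mul _ hdet, Matrix.one_mul]
  rw [htr, htr, h2, Matrix.trace_mul_comm, Matrix.mul_assoc, Matrix.mul_nonsing_inv _ hdet,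
    Matrix.mul_one, Matrix.trace_conjTranspose]
  rfl

/-- The inner product of two characters is the dimension of a space of intertwining maps. -/
theorem groupInner_character [Finite G] {d e : ℕ} (σ : Representation ℂ G (Fin d → ℂ))
    (ρ : Representation ℂ G (Fin e → ℂ)) :
    groupInner σ.character ρ.character =
      (Module.finrank ℂ (Representation.IntertwiningMap ρ σ) : ℂ) := by
  have := Fintype.ofFinite G
  have hc : (Nat.card G : ℂ) ≠ 0 := Nat.cast_ne_zero.2 Nat.card_pos.ne'
  have := invertibleOfNonzero hc
  rw [← Representation.card_inv_mul_sum_char_mul_char_eq_finrank, groupInner,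
    finsum_eq_sum_of_fintype]
  simp only [Representation.character_inv_eq_conj]

/-- Injective intertwining maps of complex representations of a finite group split. -/
theorem Representation.IntertwiningMap.exists_leftInverse [Finite G] {V W : Type*}
    [AddCommGroup V] [Module ℂ V] [AddCommGroup W] [Module ℂ W]
    {ρ : Representation ℂ G V} {σ : Representation ℂ G W}
    (f : IntertwiningMap ρ σ) (hf : Function.Injective f) :
    ∃ g : IntertwiningMap σ ρ, ∀ v, g (f v) = v := by
  have : NeZero (Nat.card G : ℂ) := ⟨Nat.cast_ne_zero.2 Nat.card_pos.ne'⟩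
  obtain ⟨g, hg⟩ := MonoidAlgebra.exists_leftInverse_of_injective
    (equivLinearMapAsModule ρ σ f) (LinearMap.ker_eq_bot.2 hf)
  exact ⟨(equivLinearMapAsModule σ ρ).symm g, fun v => LinearMap.congr_fun hg v⟩

/-- Two characters with a common irreducible constituent are not orthogonal. -/
theorem groupInner_ne_zero_of_mem_irrConstituents [Finite G] {χ χ' ψ : G → ℂ} (hχ : IsChar χ)
    (hχ' : IsChar χ') (h : ψ ∈ irrConstituents χ) (h' : ψ ∈ irrConstituents χ') :
    groupInner χ χ' ≠ 0 := by
  obtain ⟨d, σ, rfl⟩ := hχ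
  obtain ⟨d', σ', rfl⟩ := hχ'
  obtain ⟨⟨e, ρ, hρ, rfl⟩, hpos⟩ := h
  have hpos' := h'.2
  rw [groupInner_character] at hpos hpos' ⊢
  have key : ∀ {k : ℕ} (τ : Representation ℂ G (Fin k → ℂ)),
      (Module.finrank ℂ (Representation.IntertwiningMap ρ τ) : ℂ) ≠ 0 →
      ∃ f : Representation.IntertwiningMap ρ τ, f ≠ 0 ∧ Function.Injective f := by
    intro k τ hk
    have : Nontrivial (Representation.IntertwiningMap ρ τ) :=
      Module.nontrivial_of_finrank_pos (R := ℂ) (Nat.pos_of_ne_zero (by exact_mod_cast hk))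
    obtain ⟨f, hf⟩ := exists_ne (0 : Representation.IntertwiningMap ρ τ)
    exact ⟨f, hf, (Representation.IsIrreducible.injective_or_eq_zero f).resolve_right hf⟩
  open scoped ComplexOrder in
  obtain ⟨f, hf0, hf⟩ := key σ hpos.ne'
  open scoped ComplexOrder in
  obtain ⟨f', -, hf'⟩ := key σ' hpos'.ne'
  obtain ⟨g, hg⟩ := f'.exists_leftInverse hf'
  -- The irreducible embeds in both representations; retracting one copy and including the other
  -- gives a nonzero map between them.
  have hne : (f.comp g) ≠ 0 := by
    intro h0
    apply hf0
    ext1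
    refine LinearMap.ext fun v => ?_
    have := DFunLike.congr_fun h0 (f' v)
    change f (g (f' v)) = 0 at this
    rwa [hg] at this
  have hfin : Module.Finite ℂ (Representation.IntertwiningMap σ' σ) :=
    Module.Finite.of_injective (Representation.IntertwiningMap.toLinearMapl σ' σ)
      (Representation.IntertwiningMap.toLinearMap_injective σ' σ)
  have : Nontrivial (Representation.IntertwiningMap σ' σ) := ⟨f.comp g, 0, hne⟩
  exact_mod_cast (Module.finrank_pos (R := ℂ) (M := Representation.IntertwiningMap σ' σ)).ne'

/-- The inner product with an irreducible character detects constituents. -/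
theorem mem_irrConstituents_iff [Finite G] {χ ψ : G → ℂ} (hχ : IsChar χ) :
    ψ ∈ irrConstituents χ ↔ ψ ∈ irrChars G ∧ groupInner χ ψ ≠ 0 := by
  refine and_congr_right fun h => ?_
  obtain ⟨d, σ, rfl⟩ := hχ
  obtain ⟨e, ρ, hρ, rfl⟩ := h
  rw [groupInner_character]
  open scoped ComplexOrder in
  simp [pos_iff_ne_zero]

/-- A representation on a finite-dimensional space, transported to a coordinate space. -/
theorem Representation.exists_equiv_fin {V : Type*} [AddCommGroup V] [Module ℂ V]
    [Module.Finite ℂ V] (ρ : Representation ℂ G V) :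
    ∃ σ : Representation ℂ G (Fin (Module.finrank ℂ V) → ℂ), Nonempty (σ.Equiv ρ) := by
  let e := (Module.finBasis ℂ V).equivFun
  let σ : Representation ℂ G (Fin (Module.finrank ℂ V) → ℂ) :=
    { toFun := fun g => e.toLinearMap ∘ₗ ρ g ∘ₗ e.symm.toLinearMap
      map_one' := by ext; simp
      map_mul' := fun a b => by ext; simp }
  refine ⟨σ, ⟨Representation.Equiv.mk e.symm fun g => ?_⟩⟩
  ext v
  simp [σ]

theorem Representation.isChar_character {V : Type*} [AddCommGroup V] [Module ℂ V]
    [Module.Finite ℂ V] (ρ : Representation ℂ G V) : IsChar ρ.character := by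
  obtain ⟨σ, ⟨e⟩⟩ := ρ.exists_equiv_fin
  exact ⟨_, σ, (Representation.char_iso e).symm⟩

/-- Every nonzero character has an irreducible constituent. -/
theorem irrConstituents_nonempty [Finite G] {χ : G → ℂ} (hχ : IsChar χ) (h1 : χ 1 ≠ 0) :
    (irrConstituents χ).Nonempty := by
  classical
  have hχ' := hχ
  obtain ⟨d, σ, rfl⟩ := hχ
  have hd : 0 < d := by
    rw [Representation.char_one] at h1
    simp only [Module.finrank_fin_fun] at h1
    exact Nat.pos_of_ne_zero (by exact_mod_cast h1)
  -- A nonzero representation of least dimension embedding in `σ` must be irreducible, since a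
  -- proper nonzero subrepresentation would embed with smaller dimension.
  have hex : ∃ e : ℕ, 0 < e ∧ ∃ (ρ : Representation ℂ G (Fin e → ℂ))
      (f : Representation.IntertwiningMap ρ σ), Function.Injective f :=
    ⟨d, hd, σ, Representation.IntertwiningMap.id σ, fun _ _ h => h⟩
  obtain ⟨e, ⟨he, ρ, f, hf⟩, hmin⟩ : ∃ e : ℕ, (0 < e ∧ ∃ (ρ : Representation ℂ G (Fin e → ℂ))
      (f : Representation.IntertwiningMap ρ σ), Function.Injective f) ∧ ∀ m < e, ¬ (0 < m ∧
      ∃ (ρ : Representation ℂ G (Fin m → ℂ)) (f : Representation.IntertwiningMap ρ σ),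
        Function.Injective f) :=
    ⟨Nat.find hex, Nat.find_spec hex, fun m hm => Nat.find_min hex hm⟩
  have hirr : ρ.IsIrreducible := by
    have : Nontrivial (Subrepresentation ρ) := by
      refine ⟨⊥, ⊤, fun h => ?_⟩
      have h2 : (⊥ : Submodule ℂ (Fin e → ℂ)) = ⊤ := congrArg Subrepresentation.toSubmodule h
      have h3 := congrArg (fun p : Submodule ℂ (Fin e → ℂ) => Module.finrank ℂ p) h2
      simp at h3
      omega
    refine ⟨fun U => ?_⟩
    by_contra! hU
    have hfr : 0 < Module.finrank ℂ U.toSubmodule := by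
      rw [Nat.pos_iff_ne_zero]
      intro h0
      exact hU.1 (Subrepresentation.toSubmodule_injective (Submodule.finrank_eq_zero.1 h0))
    have hlt : Module.finrank ℂ U.toSubmodule < e := by
      have := Submodule.finrank_lt (s := U.toSubmodule) (by
        intro h0
        exact hU.2 (Subrepresentation.toSubmodule_injective h0))
      simpa using this
    obtain ⟨τ, ⟨ε⟩⟩ := U.toRepresentation.exists_equiv_fin
    refine hmin _ hlt ⟨hfr, τ, ⟨f.toLinearMap ∘ₗ U.toSubmodule.subtype ∘ₗ ε.toLinearMap, ?_⟩, ?_⟩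
    · intro g
      refine LinearMap.ext fun v => ?_
      change f (U.toSubmodule.subtype (ε (τ g v))) = σ g (f (U.toSubmodule.subtype (ε v)))
      have hε : ε (τ g v) = U.toRepresentation g (ε v) := LinearMap.congr_fun (ε.toIntertwiningMap.isIntertwining' g) v
      rw [← f.isIntertwining, hε]
      rfl
    · intro v w hvw
      have := hf hvw
      exact ε.injective (Subtype.ext this)
  refine ⟨ρ.character, (mem_irrConstituents_iff hχ').2 ⟨⟨_, ρ, hirr, rfl⟩, ?_⟩⟩
  rw [groupInner_character]
  have hne : f ≠ 0 := by
    intro h0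
    have : Nontrivial (Fin e → ℂ) := by
      have : Nonempty (Fin e) := ⟨⟨0, he⟩⟩
      infer_instance
    obtain ⟨v, hv⟩ := exists_ne (0 : Fin e → ℂ)
    apply hv
    apply hf
    rw [h0]; rfl
  have hfin : Module.Finite ℂ (Representation.IntertwiningMap ρ σ) :=
    Module.Finite.of_injective (Representation.IntertwiningMap.toLinearMapl ρ σ)
      (Representation.IntertwiningMap.toLinearMap_injective ρ σ)
  have : Nontrivial (Representation.IntertwiningMap ρ σ) := ⟨f, 0, hne⟩
  exact_mod_cast (Module.finrank_pos (R := ℂ) (M := Representation.IntertwiningMap ρ σ)).ne'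

/-- An irreducible character has norm one. -/
theorem groupInner_self_of_mem_irrChars [Finite G] {χ : G → ℂ} (hχ : χ ∈ irrChars G) :
    groupInner χ χ = 1 := by
  obtain ⟨d, ρ, hρ, rfl⟩ := hχ
  rw [groupInner_character, Representation.IsIrreducible.finrank_intertwiningMap_self]
  simp

theorem apply_one_ne_zero_of_mem_irrChars {χ : G → ℂ} (hχ : χ ∈ irrChars G) : χ 1 ≠ 0 := by
  obtain ⟨d, ρ, hρ, rfl⟩ := hχ
  rw [Representation.char_one, Module.finrank_fin_fun, Nat.cast_ne_zero]
  rintro rfl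
  obtain ⟨U, U', h⟩ := hρ.toNontrivial
  exact h (Subrepresentation.toSubmodule_injective (Subsingleton.elim _ _))

theorem regularChar_apply [Finite G] [DecidableEq G] (g : G) :
    regularChar G g = if g = 1 then (Nat.card G : ℂ) else 0 := by
  have := Fintype.ofFinite G
  rw [regularChar, Representation.character,
    LinearMap.trace_eq_matrix_trace ℂ (MonoidAlgebra.basis G ℂ), Matrix.trace]
  have hrepr : ∀ x y : G, (MonoidAlgebra.basis G ℂ).repr (MonoidAlgebra.single x 1) y =
      if x = y then 1 else 0 := fun x y => Finsupp.single_apply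
  simp only [Matrix.diag_apply, LinearMap.toMatrix_apply, MonoidAlgebra.basis_apply,
    Representation.ofMulAction_single, smul_eq_mul, hrepr]
  split_ifs with h
  · subst h; simp
  · refine Finset.sum_eq_zero fun x _ => ?_
    simp [h]

/-- The restriction of a linear endomorphism to the range of a commuting idempotent. -/
theorem LinearMap.trace_restrict_range_of_isIdempotent {V : Type*} [AddCommGroup V] [Module ℂ V]
    [Module.Finite ℂ V] (f P : V →ₗ[ℂ] V) (hP : P ∘ₗ P = P)
    (h : ∀ v ∈ LinearMap.range P, f v ∈ LinearMap.range P) :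
    LinearMap.trace ℂ _ (f.restrict h) = LinearMap.trace ℂ V (f ∘ₗ P) := by
  have hP' : P = (LinearMap.range P).subtype ∘ₗ P.rangeRestrict := by ext; rfl
  -- Factor `P` as inclusion after projection and rotate the projection to the front of the trace.
  conv_rhs => rw [hP', ← LinearMap.comp_assoc, LinearMap.trace_comp_comm']
  congr 1
  ext ⟨v, hv⟩
  obtain ⟨w, hw⟩ := h v hv
  have : P (P w) = P w := LinearMap.congr_fun hP w
  simp [← hw, this]

/-- A function induced from a linear character of a subgroup is a character. -/
theorem isChar_indFun [Finite G] (H : Subgroup G) (f : G → ℂ) (h1 : f 1 = 1)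
    (hmul : ∀ a ∈ H, ∀ b ∈ H, f (a * b) = f a * f b) : IsChar (indFun H f) := by
  classical
  have := Fintype.ofFinite G
  have hc : (Nat.card H : ℂ) ≠ 0 := Nat.cast_ne_zero.2 Nat.card_pos.ne'
  -- The induced representation is realized by right translation on the functions with `φ(hx) =
  -- f(h)φ(x)`; `P` below is the averaging projection onto them.
  let ρ : Representation ℂ G (G → ℂ) :=
    { toFun := fun g => LinearMap.funLeft ℂ ℂ (· * g)
      map_one' := by ext; simp [LinearMap.funLeft_apply]
      map_mul' := fun a b => by ext; simp [LinearMap.funLeft_apply, mul_assoc] }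
  have hρ : ∀ g φ x, ρ g φ x = φ (x * g) := fun _ _ _ => rfl
  let P : (G → ℂ) →ₗ[ℂ] (G → ℂ) :=
    (Nat.card H : ℂ)⁻¹ • ∑ h : H, (f (h : G)⁻¹ • LinearMap.funLeft ℂ ℂ (fun y : G => (h : G) * y) : (G → ℂ) →ₗ[ℂ] (G → ℂ))
  have hPapp : ∀ φ x, P φ x = (Nat.card H : ℂ)⁻¹ * ∑ h : H, f (h : G)⁻¹ * φ (h * x) := by
    intro φ x
    simp [P, LinearMap.funLeft_apply, Finset.sum_apply]
  have hinv : ∀ (φ : G → ℂ) (x : G) (h : H), P φ (h * x) = f h * P φ x := by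
    intro φ x h
    rw [hPapp, hPapp, mul_left_comm (f (h : G))]
    refine congrArg _ ?_
    rw [Finset.mul_sum]
    refine Fintype.sum_equiv (Equiv.mulRight h) _ _ fun k => ?_
    have hk : f (h : G) * f ((k : G) * h)⁻¹ = f (k : G)⁻¹ := by
      rw [← hmul _ h.2 _ (H.inv_mem (H.mul_mem k.2 h.2))]
      simp
    simp only [Equiv.coe_mulRight, Subgroup.coe_mul]
    rw [← mul_assoc (f _), hk, mul_assoc]
  have hPP : P ∘ₗ P = P := by
    refine LinearMap.ext fun φ => funext fun x => ?_
    rw [LinearMap.comp_apply, hPapp]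
    have : ∀ h : H, f (h : G)⁻¹ * P φ (h * x) = P φ x := by
      intro h
      rw [hinv, ← mul_assoc, ← hmul _ (H.inv_mem h.2) _ h.2, inv_mul_cancel, h1, one_mul]
    simp only [this, Finset.sum_const, Finset.card_univ, nsmul_eq_mul, ← Nat.card_eq_fintype_card]
    rw [← mul_assoc, inv_mul_cancel₀ hc, one_mul]
  have hcomm : ∀ g φ, ρ g (P φ) = P (ρ g φ) := by
    intro g φ
    ext x
    rw [hρ, hPapp, hPapp]
    simp only [hρ, mul_assoc]
  have hstab : ∀ g, ∀ v ∈ LinearMap.range P, ρ g v ∈ LinearMap.range P := by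
    rintro g _ ⟨φ, rfl⟩
    exact ⟨ρ g φ, (hcomm g φ).symm⟩
  let U : Subrepresentation ρ := ⟨LinearMap.range P, fun g v hv => hstab g v hv⟩
  suffices indFun H f = U.toRepresentation.character by
    rw [this]; exact U.toRepresentation.isChar_character
  ext g
  have htr : U.toRepresentation.character g = LinearMap.trace ℂ _ (ρ g ∘ₗ P) :=
    LinearMap.trace_restrict_range_of_isIdempotent (ρ g) P hPP (hstab g)
  rw [htr, LinearMap.trace_eq_matrix_trace ℂ (Pi.basisFun ℂ G), Matrix.trace, indFun,
    finsum_eq_sum_of_fintype, Finset.mul_sum]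
  refine Finset.sum_congr rfl fun x _ => ?_
  rw [Matrix.diag_apply, LinearMap.toMatrix_apply, Pi.basisFun_repr, Pi.basisFun_apply,
    LinearMap.comp_apply, hρ, hPapp]
  congr 1
  by_cases hx : x * g * x⁻¹ ∈ H
  -- The diagonal entry at `x` only sees the `h` with `hxg = x`, that is `h = (xgx⁻¹)⁻¹`.
  · rw [finsum_eq_if, if_pos hx, Finset.sum_eq_single (⟨x * g * x⁻¹, hx⟩⁻¹ : H)]
    · simp [mul_assoc]
    · intro h _ hne
      rw [Pi.single_eq_of_ne, mul_zero]
      intro he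
      apply hne
      rw [eq_inv_iff_mul_eq_one]
      ext
      simp only [Subgroup.coe_mul, Subgroup.coe_one, ← mul_assoc] at he ⊢
      rw [he, mul_inv_cancel]
    · simp
  · rw [finsum_eq_if, if_neg hx]
    refine (Finset.sum_eq_zero fun h _ => ?_).symm
    rw [Pi.single_eq_of_ne, mul_zero]
    intro he
    apply hx
    have : x * g * x⁻¹ = (h : G)⁻¹ := by
      rw [eq_inv_iff_mul_eq_one, mul_eq_one_iff_inv_eq, eq_comm, eq_inv_iff_mul_eq_one,
        ← mul_assoc, he, mul_inv_cancel]
    rw [this]; exact H.inv_mem h.2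

end CharacterTheory

/-! ### Left, right and conjugation actions on the algebra and its dual. -/

namespace AlgGroup

section Actions

variable {F n : Type*} [Field F] [NonUnitalRing n] [Module F n]
  [IsScalarTower F n n] [SMulCommClass F n n]

theorem lmul_apply (g : AlgGroup n) (X : n) : lmul F g X = X + g.val * X := rfl

theorem rmul_apply (g : AlgGroup n) (X : n) : rmul F g X = X + X * g.val := rfl

theorem rmul_mul_apply (g h : AlgGroup n) (X : n) :
    rmul F (g * h) X = rmul F h (rmul F g X) := by
  simp only [rmul_apply, val_mul, mul_add, add_mul, mul_assoc]
  abel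

theorem lmul_mul_apply (g h : AlgGroup n) (X : n) :
    lmul F (g * h) X = lmul F g (lmul F h X) := by
  simp only [lmul_apply, val_mul, mul_add, add_mul, mul_assoc]
  abel

theorem lmul_rmul_comm (g h : AlgGroup n) (X : n) :
    lmul F g (rmul F h X) = rmul F h (lmul F g X) := by
  simp only [lmul_apply, rmul_apply, mul_add, add_mul, mul_assoc]
  abel

@[simp] theorem rmul_one_apply (X : n) : rmul F (1 : AlgGroup n) X = X := by
  simp [rmul_apply]

@[simp] theorem lmul_one_apply (X : n) : lmul F (1 : AlgGroup n) X = X := by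
  simp [lmul_apply]

theorem rmul_mul_right (g : AlgGroup n) (X Y : n) : rmul F g (X * Y) = X * rmul F g Y := by
  simp only [rmul_apply, mul_add, mul_assoc]

theorem lmul_mul_left (g : AlgGroup n) (X Y : n) : lmul F g (X * Y) = lmul F g X * Y := by
  simp only [lmul_apply, add_mul, mul_assoc]

theorem rmul_mul_lmul (g : AlgGroup n) (X Y : n) : rmul F g X * Y = X * lmul F g Y := by
  simp only [rmul_apply, lmul_apply, add_mul, mul_add, mul_assoc]

variable [IsNilpotentAlgebra n]

variable (F) in
/-- Conjugation `X ↦ gXg⁻¹` on the algebra. -/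
noncomputable def conj (g : AlgGroup n) : n →ₗ[F] n := lmul F g ∘ₗ rmul F g⁻¹

theorem conj_apply (g : AlgGroup n) (X : n) : conj F g X = lmul F g (rmul F g⁻¹ X) := rfl

@[simp] theorem conj_one_apply (X : n) : conj F (1 : AlgGroup n) X = X := by
  simp [conj_apply]

theorem conj_mul_apply (g h : AlgGroup n) (X : n) :
    conj F (g * h) X = conj F g (conj F h X) := by
  simp only [conj_apply, mul_inv_rev, lmul_mul_apply, rmul_mul_apply, lmul_rmul_comm]

@[simp] theorem conj_conj_inv (g : AlgGroup n) (X : n) : conj F g (conj F g⁻¹ X) = X := by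
  rw [← conj_mul_apply, mul_inv_cancel, conj_one_apply]

/-- The inner `g⁻¹` of the first factor moves across the product by `rmul_mul_lmul` and cancels the
`g` of the second. -/
theorem conj_mul (g : AlgGroup n) (X Y : n) : conj F g (X * Y) = conj F g X * conj F g Y := by
  simp only [conj_apply]
  rw [lmul_rmul_comm, lmul_rmul_comm, rmul_mul_lmul, ← lmul_mul_apply]
  simp [lmul_mul_left, rmul_mul_right, lmul_rmul_comm]

theorem val_conj (g h : AlgGroup n) : (g * h * g⁻¹).val = conj F g h.val := by
  have h1 : ∀ a b : AlgGroup n, (a * b).val = b.val + rmul F b a.val := fun a b => by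
    simp only [val_mul, rmul_apply]; abel
  have h2 : ∀ a b : AlgGroup n, (a * b).val = a.val + lmul F a b.val := fun a b => by
    simp only [val_mul, lmul_apply]; abel
  rw [h1, h2 g h, map_add, ← add_assoc, ← h1, mul_inv_cancel, val_one, zero_add, conj_apply,
    lmul_rmul_comm]

theorem coadj_apply (lam : Module.Dual F n) (g : AlgGroup n) (X : n) :
    coadj lam g X = lam (conj F g X) := rfl

theorem rightAct_apply (lam : Module.Dual F n) (g : AlgGroup n) (X : n) :
    rightAct lam g X = lam X + lam (X * g⁻¹.val) := by
  simp [rightAct, rmul_apply]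

theorem rightAct_apply' (lam : Module.Dual F n) (g : AlgGroup n) (X : n) :
    rightAct lam g X = lam (rmul F g⁻¹ X) := rfl

@[simp] theorem coadj_one (lam : Module.Dual F n) : coadj lam 1 = lam := by
  ext X; rw [coadj_apply, conj_one_apply]

theorem coadj_mul (lam : Module.Dual F n) (g h : AlgGroup n) :
    coadj lam (g * h) = coadj (coadj lam g) h := by
  ext X; simp only [coadj_apply, conj_mul_apply]

@[simp] theorem rightAct_one (lam : Module.Dual F n) : rightAct lam 1 = lam := by
  ext X; rw [rightAct_apply', inv_one, rmul_one_apply]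

theorem rightAct_mul (lam : Module.Dual F n) (g h : AlgGroup n) :
    rightAct lam (g * h) = rightAct (rightAct lam g) h := by
  ext X; simp only [rightAct_apply', mul_inv_rev, rmul_mul_apply]

theorem coadj_rightAct (lam : Module.Dual F n) (g s : AlgGroup n) :
    rightAct (coadj lam g) s = coadj (rightAct lam (g * s * g⁻¹)) g := by
  ext X
  simp only [coadj_apply, rightAct_apply', conj_apply, ← lmul_rmul_comm, ← rmul_mul_apply]
  congr 3
  group

/-- The left action of `g` followed by the right action of `g⁻¹` is the coadjoint action of `g⁻¹`;
this is the form of `Ξ_λ` used from here on. -/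
theorem mem_Xi {lam ν : Module.Dual F n} :
    ν ∈ Xi lam ↔ ∃ g : AlgGroup n, ∃ s ∈ SBar lam, ν = coadj (rightAct lam s) g := by
  have key : ∀ (g : AlgGroup n) (κ : Module.Dual F n),
      rightAct (leftAct g κ) g⁻¹ = coadj κ g⁻¹ := by
    intro g κ
    ext X
    simp [rightAct_apply', coadj_apply, conj_apply, leftAct]
  constructor
  · rintro ⟨g, s, hs, rfl⟩
    exact ⟨g⁻¹, s, hs, key _ _⟩
  · rintro ⟨g, s, hs, rfl⟩
    exact ⟨g⁻¹, s, hs, by rw [key, inv_inv]⟩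

theorem mem_SBar {lam : Module.Dual F n} {g : AlgGroup n} : g ∈ SBar lam ↔ g.val ∈ sBar lam :=
  Iff.rfl

theorem mem_LBar {lam : Module.Dual F n} {g : AlgGroup n} : g ∈ LBar lam ↔ g.val ∈ lBar lam :=
  Iff.rfl

theorem inv_val_mem {h : NonUnitalSubalgebra F n} {g : AlgGroup n} (hg : g.val ∈ h) :
    g⁻¹.val ∈ h := (algSubgroup h).inv_mem hg

end Actions

/-! ### The two chains, their stabilization and orthogonality relations. -/

section Chains

variable {F n : Type*} [Field F] [NonUnitalRing n] [Module F n]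
  [IsScalarTower F n n] [SMulCommClass F n n]

theorem lStep_le (lam : Module.Dual F n) (t : NonUnitalSubalgebra F n) : lStep lam t ≤ t :=
  fun _ hX => hX.1

theorem sStep_le (lam : Module.Dual F n) (t : NonUnitalSubalgebra F n) : sStep lam t ≤ t :=
  fun _ hX => hX.1

theorem lStep_le_sStep (lam : Module.Dual F n) (t : NonUnitalSubalgebra F n) :
    lStep lam t ≤ sStep lam t :=
  fun _ hX => ⟨hX.1, fun Y hY => hX.2 Y hY.1⟩

/-- The left kernel is a right ideal of `t`, because `t` is closed under multiplication. -/
theorem mul_mem_lStep {lam : Module.Dual F n} {t : NonUnitalSubalgebra F n} {X Y : n}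
    (hX : X ∈ lStep lam t) (hY : Y ∈ t) : X * Y ∈ lStep lam t :=
  ⟨t.mul_mem hX.1 hY, fun Z hZ => by rw [mul_assoc]; exact hX.2 _ (t.mul_mem hY hZ)⟩

theorem lStep_le_lStep_sStep (lam : Module.Dual F n) (t : NonUnitalSubalgebra F n) :
    lStep lam t ≤ lStep lam (sStep lam t) :=
  fun _ hX => ⟨lStep_le_sStep lam t hX, fun Y hY => hX.2 Y hY.1⟩

theorem sChain_antitone (lam : Module.Dual F n) : Antitone (sChain lam) :=
  antitone_nat_of_succ_le fun _ => sStep_le _ _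

theorem lChain_monotone (lam : Module.Dual F n) : Monotone (lChain lam) :=
  monotone_nat_of_le_succ fun i => by
    cases i with
    | zero => exact bot_le
    | succ i => exact lStep_le_lStep_sStep _ _

theorem lChain_le_sChain (lam : Module.Dual F n) (i : ℕ) : lChain lam i ≤ sChain lam i := by
  cases i with
  | zero => exact bot_le
  | succ i => exact lStep_le_sStep _ _

variable [Module.Finite F n]

/-- With `k = d - 1`, the equality of terms `k` and `d` of the descending chain makes `s̄` a fixed
point of `sStep`, and puts `l̄`, which is term `k + 1`, over that same `s̄`. -/
theorem exists_sBar_eq (lam : Module.Dual F n) :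
    ∃ k, sBar lam = sChain lam k ∧ sStep lam (sChain lam k) = sChain lam k ∧
      lBar lam = lStep lam (sChain lam k) := by
  obtain ⟨h1, h2⟩ := chainEnd_spec lam
  obtain ⟨k, hk⟩ : ∃ k, chainEnd lam = k + 1 := ⟨chainEnd lam - 1, by omega⟩
  rw [hk, Nat.add_sub_cancel] at h2
  refine ⟨k, ?_, h2.symm, ?_⟩
  · rw [sBar, hk, h2]
  · rw [lBar, hk]; rfl

theorem sStep_sBar (lam : Module.Dual F n) : sStep lam (sBar lam) = sBar lam := by
  obtain ⟨k, h1, h2, -⟩ := exists_sBar_eq lam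
  rw [h1, h2]

theorem lBar_eq (lam : Module.Dual F n) : lBar lam = lStep lam (sBar lam) := by
  obtain ⟨k, h1, -, h2⟩ := exists_sBar_eq lam
  rw [h1, h2]

theorem mem_sBar {lam : Module.Dual F n} {X : n} :
    X ∈ sBar lam ↔ ∀ i, X ∈ sChain lam i := by
  obtain ⟨k, h1, h2, -⟩ := exists_sBar_eq lam
  refine ⟨fun hX i => ?_, fun h => h1 ▸ h k⟩
  rw [h1] at hX
  rcases le_total i k with h | h
  · exact sChain_antitone lam h hX
  · have : sChain lam i = sChain lam k := by
      induction i, h using Nat.le_induction with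
      | base => rfl
      | succ i _ ih => rw [sChain, ih, h2]
    rwa [this]

theorem sBar_le (lam : Module.Dual F n) (i : ℕ) : sBar lam ≤ sChain lam i :=
  fun _ hX => mem_sBar.1 hX i

theorem lBar_le_sBar (lam : Module.Dual F n) : lBar lam ≤ sBar lam := by
  rw [lBar_eq]; exact lStep_le _ _

/-- Both chains are compared at a common index: an element of `l_λ^i` lies in every `s_λ^j`, via
`l_λ^j` for `j ≥ i` and via `s_λ^i` for `j ≤ i`. -/
theorem lChain_le_lBar (lam : Module.Dual F n) (i : ℕ) : lChain lam i ≤ lBar lam := by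
  intro X hX
  have hs : ∀ j, X ∈ sChain lam j := by
    intro j
    rcases le_total i j with h | h
    · exact lChain_le_sChain lam j (lChain_monotone lam h hX)
    · exact sChain_antitone lam h (lChain_le_sChain lam i hX)
  rw [lBar_eq]
  refine ⟨mem_sBar.2 hs, fun Y hY => ?_⟩
  cases i with
  | zero =>
    have : X = 0 := NonUnitalAlgebra.mem_bot.1 hX
    simp [this]
  | succ i => exact hX.2 Y (sBar_le lam i hY)

theorem apply_mul_of_mem_lBar_left {lam : Module.Dual F n} {X Y : n} (hX : X ∈ lBar lam)
    (hY : Y ∈ sBar lam) : lam (X * Y) = 0 := by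
  rw [lBar_eq] at hX
  exact hX.2 Y hY

/-- This is where stabilization enters: a further `sStep` does not shrink `s̄`, so `l̄` is
orthogonal to `s̄` on the right as well. -/
theorem apply_mul_of_mem_lBar_right {lam : Module.Dual F n} {X Y : n} (hX : X ∈ sBar lam)
    (hY : Y ∈ lBar lam) : lam (X * Y) = 0 := by
  rw [← sStep_sBar] at hX
  rw [lBar_eq] at hY
  exact hX.2 Y hY

theorem mul_mem_lBar_left {lam : Module.Dual F n} {X Y : n} (hX : X ∈ lBar lam)
    (hY : Y ∈ sBar lam) : X * Y ∈ lBar lam := by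
  rw [lBar_eq] at hX ⊢
  exact mul_mem_lStep hX hY

/-- A functional on `s` vanishing on the left kernel of `(X, Y) ↦ λ(XY)` on `s × t` has the form
`X ↦ λ(XY)` with `Y ∈ t`. -/
theorem exists_eq_apply_mul (lam : Module.Dual F n) (s t : Submodule F n) (f : Module.Dual F n)
    (hf : ∀ X ∈ s, (∀ Y ∈ t, lam (X * Y) = 0) → f X = 0) :
    ∃ Y ∈ t, ∀ X ∈ s, f X = lam (X * Y) := by
  let B : s →ₗ[F] Module.Dual F t :=
    ((LinearMap.mul F n).compr₂ lam).compl₁₂ s.subtype t.subtype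
  have hB : ∀ (X : s) (Y : t), B X Y = lam (X * Y) := fun _ _ => rfl
  -- The range of a transpose is the annihilator of the kernel; reflexivity of `t` then turns the
  -- preimage `φ` into an element `Y`.
  have hmem : f ∘ₗ s.subtype ∈ LinearMap.range B.dualMap := by
    rw [LinearMap.range_dualMap_eq_dualAnnihilator_ker, Submodule.mem_dualAnnihilator]
    intro X hX
    refine hf X X.2 fun Y hY => ?_
    rw [LinearMap.mem_ker] at hX
    rw [← hB X ⟨Y, hY⟩, hX]
    rfl
  obtain ⟨φ, hφ⟩ := hmem
  refine ⟨(Module.evalEquiv F t).symm φ, Submodule.coe_mem _, fun X hX => ?_⟩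
  have h1 := LinearMap.congr_fun hφ ⟨X, hX⟩
  change φ (B ⟨X, hX⟩) = f X at h1
  rw [← h1, ← hB ⟨X, hX⟩, Module.apply_evalEquiv_symm_apply]

end Chains

/-! ### Behaviour of the chains under right translation and conjugation. -/

section ChainsAction

variable {F n : Type*} [Field F] [NonUnitalRing n] [Module F n]
  [IsScalarTower F n n] [SMulCommClass F n n] [IsNilpotentAlgebra n]

/-- Translating `λ` by `g ∈ 1 + t` only replaces `Y` by `Yg⁻¹`, which stays in `t`. Applying this to
`g⁻¹` gives the reverse inclusion. -/
theorem lStep_le_rightAct (lam : Module.Dual F n) {t : NonUnitalSubalgebra F n} {g : AlgGroup n}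
    (hg : g.val ∈ t) : lStep lam t ≤ lStep (rightAct lam g) t := fun X hX =>
  ⟨hX.1, fun Y hY => by
    rw [rightAct_apply, hX.2 Y hY, mul_assoc, hX.2 _ (t.mul_mem hY (inv_val_mem hg)), add_zero]⟩

theorem lStep_rightAct (lam : Module.Dual F n) {t : NonUnitalSubalgebra F n} {g : AlgGroup n}
    (hg : g.val ∈ t) : lStep (rightAct lam g) t = lStep lam t := by
  refine le_antisymm ?_ (lStep_le_rightAct lam hg)
  have := lStep_le_rightAct (rightAct lam g) (inv_val_mem hg)
  rwa [← rightAct_mul, mul_inv_cancel, rightAct_one] at this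

theorem sStep_le_rightAct (lam : Module.Dual F n) {t : NonUnitalSubalgebra F n} {g : AlgGroup n}
    (hg : g.val ∈ t) : sStep lam t ≤ sStep (rightAct lam g) t := fun X hX =>
  ⟨hX.1, fun Y hY => by
    rw [lStep_rightAct lam hg] at hY
    rw [rightAct_apply, hX.2 Y hY, mul_assoc, hX.2 _ (mul_mem_lStep hY (inv_val_mem hg)),
      add_zero]⟩

theorem sStep_rightAct (lam : Module.Dual F n) {t : NonUnitalSubalgebra F n} {g : AlgGroup n}
    (hg : g.val ∈ t) : sStep (rightAct lam g) t = sStep lam t := by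
  refine le_antisymm ?_ (sStep_le_rightAct lam hg)
  have := sStep_le_rightAct (rightAct lam g) (inv_val_mem hg)
  rwa [← rightAct_mul, mul_inv_cancel, rightAct_one] at this

theorem mem_lStep_coadj {lam : Module.Dual F n} {g : AlgGroup n} {t t' : NonUnitalSubalgebra F n}
    (h : ∀ X, X ∈ t' ↔ conj F g X ∈ t) (X : n) :
    X ∈ lStep (coadj lam g) t' ↔ conj F g X ∈ lStep lam t := by
  refine and_congr (h X) ⟨fun H Y hY => ?_, fun H Y hY => ?_⟩
  · have := H (conj F g⁻¹ Y) ((h _).2 (by rwa [conj_conj_inv]))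
    rwa [coadj_apply, conj_mul, conj_conj_inv] at this
  · rw [coadj_apply, conj_mul]
    exact H _ ((h Y).1 hY)

theorem mem_sStep_coadj {lam : Module.Dual F n} {g : AlgGroup n} {t t' : NonUnitalSubalgebra F n}
    (h : ∀ X, X ∈ t' ↔ conj F g X ∈ t) (X : n) :
    X ∈ sStep (coadj lam g) t' ↔ conj F g X ∈ sStep lam t := by
  refine and_congr (h X) ⟨fun H Y hY => ?_, fun H Y hY => ?_⟩
  · have := H (conj F g⁻¹ Y) ((mem_lStep_coadj h _).2 (by rwa [conj_conj_inv]))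
    rwa [coadj_apply, conj_mul, conj_conj_inv] at this
  · rw [coadj_apply, conj_mul]
    exact H _ ((mem_lStep_coadj h Y).1 hY)

theorem mem_sChain_coadj {lam : Module.Dual F n} {g : AlgGroup n} (i : ℕ) (X : n) :
    X ∈ sChain (coadj lam g) i ↔ conj F g X ∈ sChain lam i := by
  induction i generalizing X with
  | zero => exact iff_of_true trivial trivial
  | succ i ih => exact mem_sStep_coadj ih X

variable [Module.Finite F n]

theorem mem_sBar_coadj {lam : Module.Dual F n} {g : AlgGroup n} (X : n) :
    X ∈ sBar (coadj lam g) ↔ conj F g X ∈ sBar lam := by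
  simp only [mem_sBar, mem_sChain_coadj]

theorem mem_SBar_coadj {lam : Module.Dual F n} {g x : AlgGroup n} :
    x ∈ SBar (coadj lam g) ↔ g * x * g⁻¹ ∈ SBar lam := by
  rw [mem_SBar, mem_SBar, mem_sBar_coadj, val_conj (F := F)]

theorem card_SBar_coadj (lam : Module.Dual F n) (g : AlgGroup n) :
    Nat.card (SBar (coadj lam g)) = Nat.card (SBar lam) := by
  refine Nat.card_congr ((MulAut.conj g).toEquiv.subtypeEquiv fun x => ?_)
  exact mem_SBar_coadj

theorem sChain_rightAct {lam : Module.Dual F n} {s : AlgGroup n} (hs : s ∈ SBar lam) (i : ℕ) :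
    sChain (rightAct lam s) i = sChain lam i := by
  induction i with
  | zero => rfl
  | succ i ih =>
    rw [sChain, ih, sStep_rightAct lam (mem_sBar.1 hs i)]
    rfl

theorem sBar_rightAct {lam : Module.Dual F n} {s : AlgGroup n} (hs : s ∈ SBar lam) :
    sBar (rightAct lam s) = sBar lam := by
  ext X
  simp only [mem_sBar, sChain_rightAct hs]

theorem SBar_rightAct {lam : Module.Dual F n} {s : AlgGroup n} (hs : s ∈ SBar lam) :
    SBar (rightAct lam s) = SBar lam := by
  rw [SBar, sBar_rightAct hs, SBar]

theorem lBar_rightAct {lam : Module.Dual F n} {s : AlgGroup n} (hs : s ∈ SBar lam) :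
    lBar (rightAct lam s) = lBar lam := by
  rw [lBar_eq, lBar_eq, sBar_rightAct hs, lStep_rightAct lam hs]

theorem rightAct_apply_of_mem_lBar {lam : Module.Dual F n} {s : AlgGroup n} (hs : s ∈ SBar lam)
    {X : n} (hX : X ∈ lBar lam) : rightAct lam s X = lam X := by
  rw [rightAct_apply, apply_mul_of_mem_lBar_left hX (inv_val_mem hs), add_zero]

theorem conj_mem {t : NonUnitalSubalgebra F n} {g : AlgGroup n} (hg : g.val ∈ t) {X : n}
    (hX : X ∈ t) : conj F g X ∈ t := by
  rw [conj_apply, lmul_apply, rmul_apply]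
  have h := t.add_mem hX (t.mul_mem hX (inv_val_mem hg))
  exact t.add_mem h (t.mul_mem hg h)

/-! ### Conjugacy of extensions and the partition into the sets `Ξ_λ`. -/

/-- All extensions of `λ|_{s_λ^i}` to the algebra are conjugate under `1 + l_λ^i`. -/
theorem exists_eq_coadj_of_eqOn_sChain (lam : Module.Dual F n) (i : ℕ) (μ : Module.Dual F n)
    (hμ : ∀ X ∈ sChain lam i, μ X = lam X) :
    ∃ x : AlgGroup n, x.val ∈ lChain lam i ∧ μ = coadj lam x := by
  induction i generalizing μ with
  | zero =>
    refine ⟨1, (lChain lam 0).zero_mem, ?_⟩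
    ext X
    rw [coadj_one, hμ X trivial]
  | succ i ih =>
    -- `s_λ^{i+1}` is the left kernel of the pairing on `s_λ^i × l_λ^{i+1}`, so `μ - λ` is `X ↦
    -- λ(XA)` on `s_λ^i`.
    obtain ⟨A, hA, hA'⟩ := exists_eq_apply_mul lam (sChain lam i).toSubmodule
      (lChain lam (i + 1)).toSubmodule (μ - lam) (fun X hX h => by
        rw [LinearMap.sub_apply, hμ X ⟨hX, h⟩, sub_self])
    let x : AlgGroup n := (⟨A⟩ : AlgGroup n)⁻¹
    have hx : x.val ∈ lChain lam (i + 1) := inv_val_mem (g := ⟨A⟩) hA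
    have hxs : x.val ∈ sChain lam i := lStep_le _ _ hx
    -- Right multiplication by `x⁻¹ = 1 + A` produces `λ(XA)`; left multiplication by `x` changes
    -- nothing, as `x - 1` lies in the left kernel of `s_λ^i`. Agreement thus improves from
    -- `s_λ^{i+1}` to `s_λ^i`.
    have hcoadj : ∀ X ∈ sChain lam i, coadj lam x X = μ X := by
      intro X hX
      have hAs : A ∈ sChain lam i := lStep_le _ _ hA
      have h1 : rmul F x⁻¹ X = X + X * A := by rw [rmul_apply, inv_inv]
      rw [coadj_apply, conj_apply, h1, lmul_apply, map_add,
        hx.2 _ ((sChain lam i).add_mem hX ((sChain lam i).mul_mem hX hAs)), map_add, ← hA' X hX,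
        LinearMap.sub_apply]
      abel
    obtain ⟨y, hy, hy'⟩ := ih (coadj μ x⁻¹) (fun X hX => by
      rw [coadj_apply, ← hcoadj _ (conj_mem (inv_val_mem hxs) hX), coadj_apply, conj_conj_inv])
    refine ⟨y * x, (algSubgroup (lChain lam (i + 1))).mul_mem (x := y) (y := x)
      (lChain_monotone lam (Nat.le_succ i) hy) hx, ?_⟩
    rw [coadj_mul, ← hy', ← coadj_mul, inv_mul_cancel, coadj_one]

theorem exists_eq_coadj_of_eqOn_sBar (lam μ : Module.Dual F n)
    (hμ : ∀ X ∈ sBar lam, μ X = lam X) : ∃ x : AlgGroup n, μ = coadj lam x :=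
  (exists_eq_coadj_of_eqOn_sChain lam (chainEnd lam) μ hμ).imp fun _ h => h.2

theorem mem_Xi_of_eqOn_lBar {lam μ : Module.Dual F n} (hμ : ∀ X ∈ lBar lam, μ X = lam X) :
    μ ∈ Xi lam := by
  obtain ⟨A, hA, hA'⟩ := exists_eq_apply_mul lam (sBar lam).toSubmodule
    (sBar lam).toSubmodule (μ - lam) (fun X hX h => by
      have : X ∈ lBar lam := by rw [lBar_eq]; exact ⟨hX, h⟩
      rw [LinearMap.sub_apply, hμ X this, sub_self])
  have hs : (⟨A⟩ : AlgGroup n)⁻¹ ∈ SBar lam := inv_val_mem (g := ⟨A⟩) hA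
  obtain ⟨x, hx⟩ := exists_eq_coadj_of_eqOn_sBar (rightAct lam (⟨A⟩ : AlgGroup n)⁻¹) μ (by
    intro X hX
    rw [sBar_rightAct hs] at hX
    rw [rightAct_apply, inv_inv, ← hA' X hX, LinearMap.sub_apply]
    abel)
  exact mem_Xi.2 ⟨x, _, hs, hx⟩

theorem eqOn_lBar_coadj_iff (lam : Module.Dual F n) (x : AlgGroup n) :
    (∀ X ∈ lBar lam, coadj lam x X = lam X) ↔ x ∈ SBar lam := by
  constructor
  · intro h
    rw [mem_SBar, mem_sBar]
    intro i
    induction i with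
    | zero => trivial
    | succ i ih =>
      refine ⟨ih, fun Y hY => ?_⟩
      -- Testing on `Yx` cancels the `x⁻¹` of the conjugation, leaving `λ(xY) = λ(Yx) = λ(Y)`, hence
      -- `λ((x - 1)Y) = 0`.
      have h1 := h (rmul F x Y) (lChain_le_lBar lam (i + 1)
        ((lStep lam (sChain lam i)).add_mem hY (mul_mem_lStep hY ih)))
      rw [coadj_apply, conj_apply, ← rmul_mul_apply, mul_inv_cancel, rmul_one_apply, lmul_apply,
        rmul_apply, map_add, map_add, hY.2 _ ih] at h1
      exact add_left_cancel h1
  · intro hx X hX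
    have hxi := inv_val_mem (mem_SBar.1 hx)
    have h1 : X + X * x⁻¹.val ∈ lBar lam := (lBar lam).add_mem hX (mul_mem_lBar_left hX hxi)
    rw [coadj_apply, conj_apply, rmul_apply, lmul_apply, map_add,
      apply_mul_of_mem_lBar_right hx h1, map_add, apply_mul_of_mem_lBar_left hX hxi]
    simp

theorem self_mem_Xi (lam : Module.Dual F n) : lam ∈ Xi lam :=
  mem_Xi_of_eqOn_lBar fun _ _ => rfl

theorem Xi_rightAct {lam : Module.Dual F n} {s : AlgGroup n} (hs : s ∈ SBar lam) :
    Xi (rightAct lam s) = Xi lam := by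
  ext ν
  simp only [mem_Xi, SBar_rightAct hs]
  constructor
  · rintro ⟨g, t, ht, rfl⟩
    exact ⟨g, s * t, mul_mem hs ht, by rw [rightAct_mul]⟩
  · rintro ⟨g, t, ht, rfl⟩
    exact ⟨g, s⁻¹ * t, mul_mem (inv_mem hs) ht, by rw [← rightAct_mul, mul_inv_cancel_left]⟩

theorem Xi_coadj (lam : Module.Dual F n) (g : AlgGroup n) : Xi (coadj lam g) = Xi lam := by
  ext ν
  simp only [mem_Xi]
  constructor
  · rintro ⟨h, t, ht, rfl⟩
    exact ⟨g * h, g * t * g⁻¹, mem_SBar_coadj.1 ht, by rw [coadj_rightAct, coadj_mul]⟩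
  · rintro ⟨h, t, ht, rfl⟩
    refine ⟨g⁻¹ * h, g⁻¹ * t * g, mem_SBar_coadj.2 (by simpa [mul_assoc] using ht), ?_⟩
    rw [coadj_rightAct, ← coadj_mul]
    simp [mul_assoc]

/-- With `self_mem_Xi`, this makes the sets `Ξ_λ` the classes of an equivalence relation. -/
theorem Xi_eq_of_mem {lam μ : Module.Dual F n} (h : μ ∈ Xi lam) : Xi μ = Xi lam := by
  obtain ⟨g, s, hs, rfl⟩ := mem_Xi.1 h
  rw [Xi_coadj, Xi_rightAct hs]

theorem card_SBar_eq_of_mem {lam μ : Module.Dual F n} (h : μ ∈ Xi lam) :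
    Nat.card (SBar μ) = Nat.card (SBar lam) := by
  obtain ⟨g, s, hs, rfl⟩ := mem_Xi.1 h
  rw [card_SBar_coadj, SBar_rightAct hs]

theorem disjoint_Xi {lam μ : Module.Dual F n} (h : μ ∉ Xi lam) : Disjoint (Xi lam) (Xi μ) := by
  rw [Set.disjoint_left]
  intro ν h1 h2
  apply h
  rw [← Xi_eq_of_mem h1, Xi_eq_of_mem h2]
  exact self_mem_Xi μ

/-- The conjugates of `μ` agreeing with `λ` on `l̄_λ`: there are `|S̄_λ|` conjugators if `μ ∈ Ξ_λ`,
and none otherwise. -/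
theorem card_coadj_eqOn_lBar (lam μ : Module.Dual F n) [Decidable (μ ∈ Xi lam)] :
    Nat.card {x : AlgGroup n // ∀ X ∈ lBar lam, coadj μ x X = lam X} =
      if μ ∈ Xi lam then Nat.card (SBar lam) else 0 := by
  split_ifs with h
  · obtain ⟨g, s, hs, rfl⟩ := mem_Xi.1 h
    -- For `μ = (λs)^g` the condition on `x` says that `gx` stabilizes the restriction of `λs` to
    -- `l̄`, where `λs` and `λ` coincide.
    refine Nat.card_congr ((Equiv.mulLeft g).subtypeEquiv fun x => ?_)
    rw [← SBar_rightAct hs, Equiv.coe_mulLeft, ← eqOn_lBar_coadj_iff, lBar_rightAct hs,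
      coadj_mul]
    exact forall₂_congr fun X hX => by rw [rightAct_apply_of_mem_lBar hs hX]
  · have : IsEmpty {x : AlgGroup n // ∀ X ∈ lBar lam, coadj μ x X = lam X} := by
      refine ⟨fun x => h ?_⟩
      have hx := mem_Xi_of_eqOn_lBar x.2
      rw [← Xi_eq_of_mem hx, Xi_coadj]
      exact self_mem_Xi μ
    exact Nat.card_of_isEmpty

/-- Right translation by `S̄_λ` fixes `λ` on `l̄`, here equal to `s̄`, and functionals agreeing on
`s̄` are already conjugate. -/
theorem Xi_eq_coadjOrbit {lam : Module.Dual F n} (h : SBar lam = LBar lam) :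
    Xi lam = coadjOrbit lam := by
  have hsl : ∀ X, X ∈ sBar lam → X ∈ lBar lam := fun X hX =>
    mem_LBar.1 (h ▸ (mem_SBar.2 hX : (⟨X⟩ : AlgGroup n) ∈ SBar lam))
  ext ν
  rw [mem_Xi]
  constructor
  · rintro ⟨g, s, hs, rfl⟩
    obtain ⟨x, hx⟩ := exists_eq_coadj_of_eqOn_sBar lam (rightAct lam s)
      fun X hX => rightAct_apply_of_mem_lBar hs (hsl X hX)
    exact ⟨x * g, by rw [hx, coadj_mul]⟩
  · rintro ⟨g, rfl⟩
    exact ⟨g, 1, one_mem _, by rw [rightAct_one]⟩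

end ChainsAction

end AlgGroup

/-! ### Additive Fourier analysis on a finite vector space. -/

section Fourier

variable {F : Type*} [Field F]

/-- Orthogonality for the additive character `θ` composed with a linear functional. -/
theorem AddChar.sum_comp_dual {V : Type*} [AddCommGroup V] [Module F V] [Fintype V]
    {θ : AddChar F ℂ} (hθ : θ ≠ 1) (φ : Module.Dual F V) [Decidable (φ = 0)] :
    ∑ x, θ (φ x) = if φ = 0 then (Nat.card V : ℂ) else 0 := by
  split_ifs with h
  · simp [h]
  · have hne : θ.compAddMonoidHom φ.toAddMonoidHom ≠ 0 := by
      obtain ⟨a, ha⟩ := AddChar.ne_one_iff.1 hθ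
      obtain ⟨x, hx⟩ : ∃ x, φ x ≠ 0 := by
        by_contra! h0
        exact h (LinearMap.ext h0)
      -- Rescaling `x` makes `φ` take the value `a`, at which `θ` is nontrivial.
      refine AddChar.ne_zero_iff.2 ⟨(a / φ x) • x, ?_⟩
      simpa [hx] using ha
    exact AddChar.sum_eq_zero_iff_ne_zero.2 hne

end Fourier

/-! ### The characters `ξ_λ`: expansion, inner products, irreducible case. -/

namespace AlgGroup

variable {F n : Type*} [Field F] [Finite F] [NonUnitalRing n] [Module F n]
  [IsScalarTower F n n] [SMulCommClass F n n] [Module.Finite F n]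

/-- The underlying set of `1 + n` is that of `n`. -/
def equivVal (n : Type*) : AlgGroup n ≃ n := ⟨val, mk, fun _ => rfl, fun _ => rfl⟩

variable (F) in
theorem finite_algebra (n : Type*) [AddCommGroup n] [Module F n] [Module.Finite F n] :
    Finite n := Module.finite_of_finite F

theorem card_dual : Nat.card (Module.Dual F n) = Nat.card (AlgGroup n) := by
  rw [Nat.card_congr (equivVal n), Module.natCard_eq_pow_finrank (K := F),
    Module.natCard_eq_pow_finrank (K := F) (V := n), Subspace.dual_finrank_eq]

variable [IsNilpotentAlgebra n]

theorem card_LBar_mul_card_dualAnnihilator (lam : Module.Dual F n) :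
    Nat.card (LBar lam) * Nat.card (lBar lam).toSubmodule.dualAnnihilator =
      Nat.card (AlgGroup n) := by
  have h1 : Nat.card (LBar lam) = Nat.card (lBar lam).toSubmodule :=
    Nat.card_congr ((equivVal n).subtypeEquiv fun _ => Iff.rfl)
  rw [h1, Nat.card_congr (equivVal n), Module.natCard_eq_pow_finrank (K := F),
    Module.natCard_eq_pow_finrank (K := F) (V := n),
    Module.natCard_eq_pow_finrank (K := F) (V := (lBar lam).toSubmodule.dualAnnihilator),
    ← pow_add, Subspace.finrank_add_finrank_dualAnnihilator_eq]

/-- Fourier expansion of the extension by zero of `θ_λ` from `l̄_λ`. -/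
theorem sum_eqOn_lBar [Fintype (Module.Dual F n)] {θ : AddChar F ℂ} (hθ : θ ≠ 1)
    (lam : Module.Dual F n) [DecidablePred fun ν : Module.Dual F n => ∀ Y ∈ lBar lam, ν Y = lam Y]
    (X : n) [Decidable (X ∈ lBar lam)] :
    ∑ ν : Module.Dual F n, (if ∀ Y ∈ lBar lam, ν Y = lam Y then θ (ν X) else 0) =
      (Nat.card (lBar lam).toSubmodule.dualAnnihilator : ℂ) *
        if X ∈ lBar lam then θ (lam X) else 0 := by
  classical
  let W := (lBar lam).toSubmodule.dualAnnihilator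
  have : Finite W := Subtype.finite
  have := Fintype.ofFinite W
  rw [← Finset.sum_filter]
  -- The functionals agreeing with `λ` on `l̄` form the coset of `λ` modulo the annihilator of `l̄`.
  have h1 : ∑ ν : Module.Dual F n with ∀ Y ∈ lBar lam, ν Y = lam Y, θ (ν X) =
      ∑ κ : W, θ (lam X) * θ ((κ : Module.Dual F n) X) := by
    symm
    refine Finset.sum_bij (fun κ _ => lam + κ) ?_ ?_ ?_ ?_
    · intro κ _
      refine Finset.mem_filter.2 ⟨Finset.mem_univ _, fun Y hY => ?_⟩
      rw [LinearMap.add_apply, (Submodule.mem_dualAnnihilator _).1 κ.2 Y hY, add_zero]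
    · intro κ _ κ' _ h
      exact Subtype.ext (add_left_cancel h)
    · intro ν hν
      refine ⟨⟨ν - lam, (Submodule.mem_dualAnnihilator _).2 fun Y hY => ?_⟩,
        Finset.mem_univ _, by simp⟩
      rw [LinearMap.sub_apply, (Finset.mem_filter.1 hν).2 Y hY, sub_self]
    · intro κ _
      rw [LinearMap.add_apply, AddChar.map_add_eq_mul]
  rw [h1, ← Finset.mul_sum]
  let φ : Module.Dual F W :=
    { toFun := fun κ => (κ : Module.Dual F n) X
      map_add' := fun _ _ => rfl
      map_smul' := fun _ _ => rfl }
  have h2 := AddChar.sum_comp_dual (V := W) hθ φ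
  -- Double annihilator: only elements of `l̄` are killed by all of `W`.
  have h3 : φ = 0 ↔ X ∈ lBar lam := by
    rw [← NonUnitalSubalgebra.mem_toSubmodule,
      ← Subspace.forall_mem_dualAnnihilator_apply_eq_zero_iff]
    exact ⟨fun h κ hκ => LinearMap.congr_fun h ⟨κ, hκ⟩, fun h => LinearMap.ext fun κ => h κ κ.2⟩
  simp only [h3] at h2
  have h4 : ∑ κ : W, θ ((κ : Module.Dual F n) X) = if X ∈ lBar lam then (Nat.card W : ℂ) else 0 :=
    h2
  rw [h4]
  split_ifs <;> ring

/-- `λ(ab) = 0` on `l̄` makes `θ_λ` multiplicative on `L̄_λ`. -/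
theorem isChar_xi (θ : AddChar F ℂ) (lam : Module.Dual F n) : IsChar (xi θ lam) := by
  have := finite_algebra F n
  have := Finite.of_equiv _ (equivVal n).symm
  refine isChar_indFun _ _ (by simp [thetaFun]) fun a ha b hb => ?_
  rw [thetaFun, thetaFun, thetaFun, val_mul, lam.map_add, lam.map_add,
    apply_mul_of_mem_lBar_left ha (lBar_le_sBar lam hb), add_zero, AddChar.map_add_eq_mul]

/-- The coadjoint action of a group element as a permutation of the dual space. -/
noncomputable def coadjEquiv (x : AlgGroup n) : Module.Dual F n ≃ Module.Dual F n where
  toFun ν := coadj ν x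
  invFun ν := coadj ν x⁻¹
  left_inv ν := by
    change coadj (coadj ν x) x⁻¹ = ν
    rw [← coadj_mul, mul_inv_cancel, coadj_one]
  right_inv ν := by
    change coadj (coadj ν x⁻¹) x = ν
    rw [← coadj_mul, inv_mul_cancel, coadj_one]

theorem xi_apply {θ : AddChar F ℂ} (hθ : θ ≠ 1) (lam : Module.Dual F n) (g : AlgGroup n) :
    xi θ lam g = (Nat.card (SBar lam) : ℂ) / (Nat.card (AlgGroup n) : ℂ) *
      ∑ᶠ ν ∈ Xi lam, thetaFun θ ν g := by
  classical
  have := finite_algebra F n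
  have := Finite.of_equiv _ (equivVal n).symm
  have := finite_algebra F (Module.Dual F n)
  have := Fintype.ofFinite (AlgGroup n)
  have := Fintype.ofFinite (Module.Dual F n)
  have hcard := card_LBar_mul_card_dualAnnihilator lam
  set N := Nat.card (lBar lam).toSubmodule.dualAnnihilator
  have hG : (Nat.card (AlgGroup n) : ℂ) ≠ 0 := Nat.cast_ne_zero.2 Nat.card_pos.ne'
  have hL : (Nat.card (LBar lam) : ℂ) ≠ 0 := Nat.cast_ne_zero.2 Nat.card_pos.ne'
  have hcardC : (Nat.card (LBar lam) : ℂ) * N = Nat.card (AlgGroup n) := by exact_mod_cast hcard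
  have hN : (N : ℂ) ≠ 0 := by
    intro h0
    rw [h0, mul_zero] at hcardC
    exact hG hcardC.symm
  -- Expand each summand by Fourier inversion, exchange the sums, and count the `x` contributing to
  -- a fixed `μ`.
  have hsum : (N : ℂ) * ∑ x : AlgGroup n,
      (if x * g * x⁻¹ ∈ LBar lam then thetaFun θ lam (x * g * x⁻¹) else 0) =
      ∑ μ : Module.Dual F n,
        (if μ ∈ Xi lam then (Nat.card (SBar lam) : ℂ) * thetaFun θ μ g else 0) := by
    have hx : ∀ x : AlgGroup n, (N : ℂ) *
        (if x * g * x⁻¹ ∈ LBar lam then thetaFun θ lam (x * g * x⁻¹) else 0) =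
        ∑ μ : Module.Dual F n, (if ∀ Y ∈ lBar lam, coadj μ x⁻¹ Y = lam Y
          then thetaFun θ μ g else 0) := by
      intro x
      have h1 := sum_eqOn_lBar hθ lam (conj F x g.val)
      simp only [mem_LBar, val_conj (F := F), thetaFun]
      rw [← h1]
      refine Fintype.sum_equiv (coadjEquiv x) _ _ fun ν => ?_
      have h2 : coadj (coadjEquiv x ν) x⁻¹ = ν := (coadjEquiv x).symm_apply_apply ν
      rw [h2]
      rfl
    rw [Finset.mul_sum, Finset.sum_congr rfl fun x _ => hx x, Finset.sum_comm]
    refine Finset.sum_congr rfl fun μ _ => ?_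
    have h3 := card_coadj_eqOn_lBar lam μ
    rw [← Equiv.sum_comp (Equiv.inv (AlgGroup n))]
    simp only [Equiv.inv_apply, inv_inv]
    rw [← Finset.sum_filter, Finset.sum_const, ← Fintype.card_subtype,
      ← Nat.card_eq_fintype_card, h3, nsmul_eq_mul]
    split_ifs <;> simp
  rw [xi, indFun, finsum_eq_sum_of_fintype, finsum_eq_sum_of_fintype]
  simp only [finsum_eq_if]
  have h4 : ∑ μ : Module.Dual F n,
      (if μ ∈ Xi lam then (Nat.card (SBar lam) : ℂ) * thetaFun θ μ g else 0) =
      (Nat.card (SBar lam) : ℂ) * ∑ μ : Module.Dual F n,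
        (if μ ∈ Xi lam then thetaFun θ μ g else 0) := by
    simp only [Finset.mul_sum, mul_ite, mul_zero]
  rw [h4] at hsum
  rw [← hcardC]
  field_simp
  linear_combination hsum

theorem xi_one (θ : AddChar F ℂ) (lam : Module.Dual F n) :
    xi θ lam 1 = (Nat.card (LBar lam) : ℂ)⁻¹ * Nat.card (AlgGroup n) := by
  have := finite_algebra F n
  have := Finite.of_equiv _ (equivVal n).symm
  have := Fintype.ofFinite (AlgGroup n)
  rw [xi, indFun, finsum_eq_sum_of_fintype]
  simp [thetaFun, one_mem]

theorem xi_one_ne_zero (θ : AddChar F ℂ) (lam : Module.Dual F n) : xi θ lam 1 ≠ 0 := by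
  have := finite_algebra F n
  have := Finite.of_equiv _ (equivVal n).symm
  rw [xi_one]
  exact mul_ne_zero (inv_ne_zero (Nat.cast_ne_zero.2 Nat.card_pos.ne'))
    (Nat.cast_ne_zero.2 Nat.card_pos.ne')

/-- Compare the induced degree `|G|/|L̄_λ|` with the value of the Fourier expansion at `1`, where
every `θ_ν` equals `1`. -/
theorem ncard_Xi {θ : AddChar F ℂ} (hθ : θ ≠ 1) (lam : Module.Dual F n) :
    (Nat.card (LBar lam) : ℂ) * (Nat.card (SBar lam) : ℂ) * ((Xi lam).ncard : ℂ) =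
      (Nat.card (AlgGroup n) : ℂ) ^ 2 := by
  classical
  have := finite_algebra F n
  have := Finite.of_equiv _ (equivVal n).symm
  have := finite_algebra F (Module.Dual F n)
  have := Fintype.ofFinite (AlgGroup n)
  have hG : (Nat.card (AlgGroup n) : ℂ) ≠ 0 := Nat.cast_ne_zero.2 Nat.card_pos.ne'
  have hL : (Nat.card (LBar lam) : ℂ) ≠ 0 := Nat.cast_ne_zero.2 Nat.card_pos.ne'
  have h1 := xi_apply hθ lam 1
  have h2 : ∑ᶠ ν ∈ Xi lam, thetaFun θ ν (1 : AlgGroup n) = ((Xi lam).ncard : ℂ) := by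
    rw [finsum_mem_eq_finite_toFinset_sum _ (Set.toFinite _), Set.ncard_eq_toFinset_card]
    simp [thetaFun]
  rw [h2, xi_one] at h1
  field_simp at h1
  linear_combination -h1

/-- The functions `θ_ν` are orthonormal. -/
theorem groupInner_sum_thetaFun {θ : AddChar F ℂ} (hθ : θ ≠ 1) [DecidableEq (Module.Dual F n)]
    (S T : Finset (Module.Dual F n)) (a b : ℂ) :
    groupInner (fun g : AlgGroup n => a * ∑ ν ∈ S, thetaFun θ ν g)
      (fun g => b * ∑ μ ∈ T, thetaFun θ μ g) = a * (starRingEnd ℂ) b * ((S ∩ T).card : ℂ) := by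
  have := finite_algebra F n
  have := Finite.of_equiv _ (equivVal n).symm
  have := Fintype.ofFinite (AlgGroup n)
  have := Fintype.ofFinite n
  have hG : (Nat.card (AlgGroup n) : ℂ) ≠ 0 := Nat.cast_ne_zero.2 Nat.card_pos.ne'
  have horth : ∀ ν μ : Module.Dual F n,
      ∑ g : AlgGroup n, thetaFun θ ν g * (starRingEnd ℂ) (thetaFun θ μ g) =
        if ν = μ then (Nat.card (AlgGroup n) : ℂ) else 0 := by
    intro ν μ
    have h := AddChar.sum_comp_dual hθ (ν - μ)
    rw [← Equiv.sum_comp (equivVal n)] at h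
    simp only [sub_eq_zero, ← Nat.card_congr (equivVal n)] at h
    rw [← h]
    refine Finset.sum_congr rfl fun g _ => ?_
    rw [thetaFun, thetaFun, ← AddChar.map_neg_eq_conj, ← AddChar.map_add_eq_mul,
      LinearMap.sub_apply, sub_eq_add_neg]
    rfl
  rw [groupInner, finsum_eq_sum_of_fintype]
  have h1 : ∀ g : AlgGroup n, a * (∑ ν ∈ S, thetaFun θ ν g) *
      (starRingEnd ℂ) (b * ∑ μ ∈ T, thetaFun θ μ g) = a * (starRingEnd ℂ) b *
      ∑ ν ∈ S, ∑ μ ∈ T, thetaFun θ ν g * (starRingEnd ℂ) (thetaFun θ μ g) := by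
    intro g
    rw [map_mul, map_sum, ← Finset.sum_mul_sum]
    ring
  have h2 : ∑ g : AlgGroup n, ∑ ν ∈ S, ∑ μ ∈ T,
      thetaFun θ ν g * (starRingEnd ℂ) (thetaFun θ μ g) =
      ((S ∩ T).card : ℂ) * Nat.card (AlgGroup n) := by
    rw [Finset.sum_comm]
    simp_rw [Finset.sum_comm (s := Finset.univ) (t := T), horth]
    simp [Finset.sum_ite_eq]
  simp only [h1]
  rw [← Finset.mul_sum, h2]
  field_simp

theorem groupInner_xi {θ : AddChar F ℂ} (hθ : θ ≠ 1) (lam μ : Module.Dual F n) :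
    groupInner (xi θ lam) (xi θ μ) =
      (Nat.card (SBar lam) : ℂ) / (Nat.card (AlgGroup n) : ℂ) *
        ((Nat.card (SBar μ) : ℂ) / (Nat.card (AlgGroup n) : ℂ)) * ((Xi lam ∩ Xi μ).ncard : ℂ) := by
  classical
  have := finite_algebra F (Module.Dual F n)
  have hx : ∀ κ : Module.Dual F n, xi θ κ = fun g => (Nat.card (SBar κ) : ℂ) /
      (Nat.card (AlgGroup n) : ℂ) * ∑ ν ∈ (Set.toFinite (Xi κ)).toFinset, thetaFun θ ν g := by
    intro κ
    ext g
    rw [xi_apply hθ, finsum_mem_eq_finite_toFinset_sum _ (Set.toFinite _)]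
  rw [hx lam, hx μ, groupInner_sum_thetaFun hθ, Set.ncard_eq_toFinset_card _ (Set.toFinite _)]
  simp only [map_div₀, Complex.conj_natCast]
  congr 4
  ext
  simp

theorem groupInner_xi_of_mem {θ : AddChar F ℂ} (hθ : θ ≠ 1) {lam μ : Module.Dual F n}
    (h : μ ∈ Xi lam) : groupInner (xi θ lam) (xi θ μ) =
      (Nat.card (SBar lam) : ℂ) / (Nat.card (LBar lam) : ℂ) := by
  have := finite_algebra F n
  have := Finite.of_equiv _ (equivVal n).symm
  have hG : (Nat.card (AlgGroup n) : ℂ) ≠ 0 := Nat.cast_ne_zero.2 Nat.card_pos.ne'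
  have hL : (Nat.card (LBar lam) : ℂ) ≠ 0 := Nat.cast_ne_zero.2 Nat.card_pos.ne'
  rw [groupInner_xi hθ, Xi_eq_of_mem h, card_SBar_eq_of_mem h, Set.inter_self]
  have h1 := ncard_Xi hθ lam
  field_simp
  linear_combination (Nat.card (SBar lam) : ℂ) * h1

theorem groupInner_xi_of_notMem {θ : AddChar F ℂ} (hθ : θ ≠ 1) {lam μ : Module.Dual F n}
    (h : μ ∉ Xi lam) : groupInner (xi θ lam) (xi θ μ) = 0 := by
  rw [groupInner_xi hθ, (disjoint_Xi h).inter_eq, Set.ncard_empty]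
  simp

theorem xi_eq_iff {θ : AddChar F ℂ} (hθ : θ ≠ 1) (lam μ : Module.Dual F n) :
    xi θ lam = xi θ μ ↔ μ ∈ Xi lam := by
  constructor
  · intro h
    by_contra hμ
    have := finite_algebra F n
    have := Finite.of_equiv _ (equivVal n).symm
    have h1 := groupInner_xi_of_notMem hθ hμ
    rw [← h, groupInner_xi_of_mem hθ (self_mem_Xi lam)] at h1
    exact div_ne_zero (Nat.cast_ne_zero.2 Nat.card_pos.ne')
      (Nat.cast_ne_zero.2 Nat.card_pos.ne') h1
  · intro h
    ext g
    rw [xi_apply hθ, xi_apply hθ, Xi_eq_of_mem h, card_SBar_eq_of_mem h]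

theorem disjoint_irrConstituents_xi {θ : AddChar F ℂ} (hθ : θ ≠ 1) {lam μ : Module.Dual F n}
    (h : μ ∉ Xi lam) : Disjoint (irrConstituents (xi θ lam)) (irrConstituents (xi θ μ)) := by
  have := finite_algebra F n
  have := Finite.of_equiv _ (equivVal n).symm
  rw [Set.disjoint_left]
  intro ψ h1 h2
  exact groupInner_ne_zero_of_mem_irrConstituents (isChar_xi θ lam) (isChar_xi θ μ) h1 h2
    (groupInner_xi_of_notMem hθ h)

theorem xi_eq_kirillov {θ : AddChar F ℂ} (hθ : θ ≠ 1) {lam : Module.Dual F n}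
    (h : xi θ lam ∈ irrChars (AlgGroup n)) : xi θ lam = kirillov θ lam := by
  have := finite_algebra F n
  have := Finite.of_equiv _ (equivVal n).symm
  have hS : (Nat.card (SBar lam) : ℝ) ≠ 0 := Nat.cast_ne_zero.2 Nat.card_pos.ne'
  have hL : (Nat.card (LBar lam) : ℂ) ≠ 0 := Nat.cast_ne_zero.2 Nat.card_pos.ne'
  have h1 := groupInner_xi_of_mem hθ (self_mem_Xi lam)
  rw [groupInner_self_of_mem_irrChars h, eq_comm, div_eq_one_iff_eq hL] at h1
  have hcard : Nat.card (SBar lam) = Nat.card (LBar lam) := by exact_mod_cast h1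
  have hSL : LBar lam = SBar lam :=
    Subgroup.eq_of_le_of_card_ge (fun _ hg => lBar_le_sBar lam hg) hcard.le
  have h2 := ncard_Xi hθ lam
  rw [← hcard, Xi_eq_coadjOrbit hSL.symm] at h2
  have h3 : (Nat.card (SBar lam) : ℝ) * (Nat.card (SBar lam) : ℝ) *
      ((coadjOrbit lam).ncard : ℝ) = (Nat.card (AlgGroup n) : ℝ) ^ 2 := by exact_mod_cast h2
  -- Norm one gave `S̄_λ = L̄_λ`, so the orbit has `(|G|/|S̄_λ|)²` elements and the two normalizing
  -- factors coincide.
  have h4 : Real.sqrt ((coadjOrbit lam).ncard : ℝ) =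
      (Nat.card (AlgGroup n) : ℝ) / (Nat.card (SBar lam) : ℝ) := by
    rw [Real.sqrt_eq_iff_mul_self_eq (by positivity) (by positivity)]
    field_simp
    linear_combination h3
  ext g
  rw [xi_apply hθ, kirillov, Xi_eq_coadjOrbit hSL.symm, h4]
  push_cast
  rw [inv_div]

/-! ### The regular character and exhaustion of the irreducible characters. -/

theorem sum_thetaFun {θ : AddChar F ℂ} (hθ : θ ≠ 1) (g : AlgGroup n) :
    ∑ᶠ μ : Module.Dual F n, thetaFun θ μ g = regularChar (AlgGroup n) g := by
  classical
  have := finite_algebra F n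
  have := Finite.of_equiv _ (equivVal n).symm
  have := finite_algebra F (Module.Dual F n)
  have := Fintype.ofFinite (Module.Dual F n)
  -- Orthogonality is applied on the dual space, to evaluation at `g - 1`, which vanishes only for
  -- `g = 1`.
  have h := AddChar.sum_comp_dual hθ (Module.Dual.eval F n g.val)
  rw [regularChar_apply, finsum_eq_sum_of_fintype, ← card_dual (F := F)]
  have h1 : Module.Dual.eval F n g.val = 0 ↔ g = 1 := by
    rw [Module.eval_apply_eq_zero_iff, AlgGroup.ext_iff, val_one]
  simp only [h1] at h
  exact h

theorem regularChar_eq_sum_xi {θ : AddChar F ℂ} (hθ : θ ≠ 1) {R : Set (Module.Dual F n)}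
    (hd : R.PairwiseDisjoint Xi) (hu : (⋃ ν ∈ R, Xi ν) = Set.univ) (g : AlgGroup n) :
    regularChar (AlgGroup n) g =
      ∑ᶠ ν ∈ R, (Nat.card (AlgGroup n) : ℂ) / (Nat.card (SBar ν) : ℂ) * xi θ ν g := by
  have := finite_algebra F n
  have := Finite.of_equiv _ (equivVal n).symm
  have := finite_algebra F (Module.Dual F n)
  rw [← sum_thetaFun hθ, ← finsum_mem_univ, ← hu,
    finsum_mem_biUnion hd (Set.toFinite _) fun _ _ => Set.toFinite _]
  refine finsum_mem_congr rfl fun ν _ => ?_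
  have hG : (Nat.card (AlgGroup n) : ℂ) ≠ 0 := Nat.cast_ne_zero.2 Nat.card_pos.ne'
  have hS : (Nat.card (SBar ν) : ℂ) ≠ 0 := Nat.cast_ne_zero.2 Nat.card_pos.ne'
  rw [xi_apply hθ]
  field_simp

theorem exists_transversal : ∃ R : Set (Module.Dual F n),
    R.PairwiseDisjoint Xi ∧ (⋃ ν ∈ R, Xi ν) = Set.univ := by
  let s : Setoid (Module.Dual F n) := Setoid.ker Xi
  refine ⟨Set.range (Quotient.out (s := s)), ?_, ?_⟩
  · rintro _ ⟨p, rfl⟩ _ ⟨q, rfl⟩ hne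
    refine disjoint_Xi fun hmem => hne ?_
    have h1 : s q.out p.out := Xi_eq_of_mem hmem
    rw [← Quotient.out_eq p, ← Quotient.out_eq q, Quotient.sound h1]
  · refine Set.eq_univ_of_forall fun μ => Set.mem_biUnion ⟨Quotient.mk s μ, rfl⟩ ?_
    have h1 : Xi (Quotient.mk s μ).out = Xi μ := Quotient.mk_out (s := s) μ
    rw [h1]
    exact self_mem_Xi μ

theorem exists_mem_irrConstituents_xi {θ : AddChar F ℂ} (hθ : θ ≠ 1) {ψ : AlgGroup n → ℂ}
    (hψ : ψ ∈ irrChars (AlgGroup n)) :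
    ∃ lam : Module.Dual F n, ψ ∈ irrConstituents (xi θ lam) := by
  classical
  have := finite_algebra F n
  have := Finite.of_equiv _ (equivVal n).symm
  have := finite_algebra F (Module.Dual F n)
  have := Fintype.ofFinite (AlgGroup n)
  have hG : (Nat.card (AlgGroup n) : ℂ) ≠ 0 := Nat.cast_ne_zero.2 Nat.card_pos.ne'
  by_contra! hno
  -- If `ψ` were orthogonal to every `ξ_λ`, it would be orthogonal to the regular character, but
  -- that pairing is the conjugate of `ψ(1)`, up to the factor `|G|`.
  have hzero : ∀ lam : Module.Dual F n,
      ∑ g : AlgGroup n, xi θ lam g * (starRingEnd ℂ) (ψ g) = 0 := by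
    intro lam
    by_contra h
    refine hno lam ((mem_irrConstituents_iff (isChar_xi θ lam)).2 ⟨hψ, ?_⟩)
    rw [groupInner, finsum_eq_sum_of_fintype]
    exact mul_ne_zero (inv_ne_zero hG) h
  obtain ⟨R, hd, hu⟩ := exists_transversal (F := F) (n := n)
  have h1 : ∑ g : AlgGroup n, regularChar (AlgGroup n) g * (starRingEnd ℂ) (ψ g) =
      Nat.card (AlgGroup n) * (starRingEnd ℂ) (ψ 1) := by
    simp [regularChar_apply]
  have h2 : ∑ g : AlgGroup n, regularChar (AlgGroup n) g * (starRingEnd ℂ) (ψ g) = 0 := by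
    simp_rw [regularChar_eq_sum_xi hθ hd hu,
      finsum_mem_eq_finite_toFinset_sum _ (Set.toFinite R), Finset.sum_mul]
    rw [Finset.sum_comm]
    refine Finset.sum_eq_zero fun ν _ => ?_
    simp_rw [mul_assoc]
    rw [← Finset.mul_sum, hzero, mul_zero]
  rw [h1] at h2
  exact mul_ne_zero hG ((map_ne_zero _).2 (apply_one_ne_zero_of_mem_irrChars hψ)) h2

end AlgGroup

/-! ### Assembly of the main theorem. -/

theorem mainTheorem1 {F n : Type*} [Field F] [Finite F] [NonUnitalRing n] [Module F n]
    [IsScalarTower F n n] [SMulCommClass F n n] [Module.Finite F n] [IsNilpotentAlgebra n]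
    (θ : AddChar F ℂ) (hθ : θ ≠ 1) :
    -- the functions `ξ_λ` are characters
    (∀ lam : Module.Dual F n, IsChar (AlgGroup.xi θ lam)) ∧
    -- (1)
    (∀ lam : Module.Dual F n,
      (∀ g : AlgGroup n, AlgGroup.xi θ lam g =
        (Nat.card (AlgGroup.SBar lam) : ℂ) / (Nat.card (AlgGroup n) : ℂ) *
          ∑ᶠ ν ∈ AlgGroup.Xi lam, AlgGroup.thetaFun θ ν g) ∧
      ((AlgGroup.Xi lam).ncard : ℚ) = (Nat.card (AlgGroup n) : ℚ) ^ 2 /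
        ((Nat.card (AlgGroup.LBar lam) : ℚ) * (Nat.card (AlgGroup.SBar lam) : ℚ))) ∧
    -- (2)
    (∀ lam lam' : Module.Dual F n,
      (AlgGroup.xi θ lam = AlgGroup.xi θ lam' ↔ lam' ∈ AlgGroup.Xi lam) ∧
      (lam' ∉ AlgGroup.Xi lam →
        Disjoint (irrConstituents (AlgGroup.xi θ lam)) (irrConstituents (AlgGroup.xi θ lam'))) ∧
      (lam' ∈ AlgGroup.Xi lam →
        groupInner (AlgGroup.xi θ lam) (AlgGroup.xi θ lam') =
          (Nat.card (AlgGroup.SBar lam) : ℂ) / (Nat.card (AlgGroup.LBar lam) : ℂ)) ∧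
      (lam' ∉ AlgGroup.Xi lam →
        groupInner (AlgGroup.xi θ lam) (AlgGroup.xi θ lam') = 0)) ∧
    -- (3)
    (∀ lam : Module.Dual F n, AlgGroup.xi θ lam ∈ irrChars (AlgGroup n) →
      AlgGroup.xi θ lam = AlgGroup.kirillov θ lam) ∧
    -- (4)
    ((∀ lam : Module.Dual F n, (irrConstituents (AlgGroup.xi θ lam)).Nonempty) ∧
      (Set.range (AlgGroup.xi (n := n) θ)).PairwiseDisjoint irrConstituents ∧
      (⋃ lam : Module.Dual F n, irrConstituents (AlgGroup.xi θ lam)) = irrChars (AlgGroup n)) ∧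
    (∀ R : Set (Module.Dual F n),
      R.PairwiseDisjoint AlgGroup.Xi → (⋃ ν ∈ R, AlgGroup.Xi ν) = Set.univ →
      ∀ g : AlgGroup n, regularChar (AlgGroup n) g =
        ∑ᶠ ν ∈ R, (Nat.card (AlgGroup n) : ℂ) / (Nat.card (AlgGroup.SBar ν) : ℂ) *
          AlgGroup.xi θ ν g) := by
  have hfn := AlgGroup.finite_algebra F n
  have hfG := Finite.of_equiv _ (AlgGroup.equivVal n).symm
  refine ⟨AlgGroup.isChar_xi θ, fun lam => ⟨AlgGroup.xi_apply hθ lam, ?_⟩, fun lam lam' =>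
    ⟨AlgGroup.xi_eq_iff hθ lam lam', AlgGroup.disjoint_irrConstituents_xi hθ,
      AlgGroup.groupInner_xi_of_mem hθ, AlgGroup.groupInner_xi_of_notMem hθ⟩,
    fun lam => AlgGroup.xi_eq_kirillov hθ,
    ⟨fun lam => irrConstituents_nonempty (AlgGroup.isChar_xi θ lam)
      (AlgGroup.xi_one_ne_zero θ lam), ?_, ?_⟩,
    fun R hd hu => AlgGroup.regularChar_eq_sum_xi hθ hd hu⟩
  · have h := AlgGroup.ncard_Xi hθ lam
    have h' : (Nat.card (AlgGroup.LBar lam) : ℚ) * (Nat.card (AlgGroup.SBar lam) : ℚ) *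
        ((AlgGroup.Xi lam).ncard : ℚ) = (Nat.card (AlgGroup n) : ℚ) ^ 2 := by exact_mod_cast h
    have hL : (Nat.card (AlgGroup.LBar lam) : ℚ) ≠ 0 := Nat.cast_ne_zero.2 Nat.card_pos.ne'
    have hS : (Nat.card (AlgGroup.SBar lam) : ℚ) ≠ 0 := Nat.cast_ne_zero.2 Nat.card_pos.ne'
    rw [← h']
    field_simp
  · rintro _ ⟨lam, rfl⟩ _ ⟨lam', rfl⟩ hne
    exact AlgGroup.disjoint_irrConstituents_xi hθ
      fun h => hne ((AlgGroup.xi_eq_iff hθ lam lam').2 h)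
  · ext ψ
    rw [Set.mem_iUnion]
    exact ⟨fun ⟨_, h⟩ => h.1, fun h => AlgGroup.exists_mem_irrConstituents_xi hθ h⟩
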